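/- Fix $\tau>0$ and $\rho:\mathbb R\to\mathbb R$. For each $n$ let $p=p(n)$, and let $X_1,\dots,X_n$ (random vectors in $\mathbb R^p$) and $\varepsilon_1,\dots,\varepsilon_n$ (real random variables) be defined on a common probability space; the dependence of $X_i,\varepsilon_i$ on $n$ is not displayed. Assume: * (O1) $p/n\to\kappa$ for some $\kappa\in(0,\infty)$. * (O2) $\rho$ is twice differentiable, convex, not linear, $\rho\ge 0$ and $\rho(0)=0$. Put $\psi=\rho'$. * (O3) $\psi(|x|)=O(|x|^m)$ as $|x|\to\infty$ for some $m$; and for every $u>0$, $\psi'$ is $L(u)$-Lipschitz on $(-u,u)$, where $L(u)\le K u^{m_1}$ for all large $u$, for some $K,m_1$. * (O4) For each $n$ the $X_i$ are i.i.d. with mean $0$ and covariance $\mathrm{Id}_p$. There are $C_n$ and $c_n>0$ such that for every convex $1$-Lipschitz $F:\mathbb R^p\to\mathbb R$ there is a deterministic $m_F$ (e.g. the mean or a median of $F(X_i)$) with $P(|F(X_i)-m_F|>t)\le C_n e^{-c_nt^2}$ for all $t>0$. Moreover $1/c_n=O((\log n)^{\alpha})$ for some $\alpha\ge0$, and $C_n\le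 \exp(K(\log n)^{\alpha'})$ for all large $n$, for some $K,\alpha'$. * (O5) $(X_i)_{i\le n}$ is independent of $(\varepsilon_i)_{i\le n}$. * (O6) For each fixed integer $k\geq 0$, $\frac1n\sum_{i=1}^n E[\psi(\varepsilon_i)^{2k}]$ remains bounded as $n\to\infty$. * (O7) For each $n$ the $\varepsilon_i$ are independent, and for some $b$ and every integer $k\ge 1$, $\mathcal E_n=\sup_{i\le n}|\varepsilon_i|$ satisfies $\mathcal E_n=O_{L_k}((\log n)^b)$. Here $Z_n=O_{L_k}(r_n)$ means that there is a constant $K$, independent of $n$, with $(E|Z_n|^k)^{1/k}\le K r_n$ for all large $n$. Let $\hat\beta=\operatorname{argmin}_{\beta\in\mathbb R^p}\frac1n\sum_{j=1}^n\rho(\varepsilon_j-X_j^{\top}\beta)+\frac\tau2\|\beta\|^2$, and let $\hat\beta_{(i)}$ be the minimizer of the same function with the $i$-th term of the sum removed (keeping the factor $\frac1n$). Let $R_j=\varepsilon_j-X_j^\top\hat\beta$, $\tilde r_{j,(i)}=\varepsilon_j-X_j^\top\hat\beta_{(i)}$, $$S_i=\frac1n\sum_{j\ne i}\psi'(\tilde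 r_{j,(i)})X_jX_j^\top,\qquad c_i=\frac1n X_i^\top(S_i+\tau \mathrm{Id}_p)^{-1}X_i,$$ $$\mathrm{prox}_c(\rho)(x)=\operatorname{argmin}_{y\in\mathbb R}\Big(c\rho(y)+\tfrac12(x-y)^2\Big),\qquad \tilde\beta_i=\hat\beta_{(i)}+\frac1n(S_i+\tau \mathrm{Id}_p)^{-1}X_i\,\psi\big(\mathrm{prox}_{c_i}(\rho)(\tilde r_{i,(i)})\big).$$ Then there is an integer $a\ge 0$ such that, for every integer $k\ge1$, uniformly in $1\le i\le n$ (that is, with a constant that does not depend on $i$), $$\|\hat\beta-\tilde\beta_i\|=O_{L_k}\Big(\frac{(\log n)^a}{n}\Big),\quad\text{in particular}\quad E\|\hat\beta-\tilde\beta_i\|^2=O\Big(\frac{(\log n)^a}{n^2}\Big);$$ and, for every integer $k\ge 1$, $$\sup_{1\le i\le n}\sup_{j\ne i}|\tilde r_{j,(i)}-R_j|=O_{L_k}\Big(\frac{(\log n)^a}{\sqrt n}\Big),\qquad \sup_{1\le i\le n}\big|R_i-\mathrm{prox}_{c_i}(\rho)(\tilde r_{i,(i)})\big|=O_{L_k}\Big(\frac{(\log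 n)^a}{\sqrt n}\Big).$$ -/

import Mathlib

open MeasureTheory ProbabilityTheory Filter Topology Asymptotics Set

noncomputable section

namespace RobustRidge

/-- A global minimizer of `F` (an arbitrary point if there is none). It is used only for
continuous, strictly convex, coercive functions, whose minimizer exists and is unique. -/
def argMin {E : Type*} [Nonempty E] (F : E → ℝ) : E :=
  Classical.epsilon fun b => ∀ b', F b ≤ F b'

/-- The proximal mapping of `c ρ`: the minimizer over `y` of `c ρ(y) + (x - y)² / 2`. -/
def prox (ρ : ℝ → ℝ) (c x : ℝ) : ℝ :=
  argMin fun y : ℝ => c * ρ y + (x - y) ^ 2 / 2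

section Estimators

variable {n p : ℕ} (ρ : ℝ → ℝ) (τ : ℝ)
  (X : Fin n → EuclideanSpace ℝ (Fin p)) (ε : Fin n → ℝ)

/-- The ridge-regularized criterion in which only the observations in `s` are used;
the normalization is `1 / n` for every `s`. -/
def objective (s : Finset (Fin n)) (β : EuclideanSpace ℝ (Fin p)) : ℝ :=
  (1 / (n : ℝ)) * ∑ j ∈ s, ρ (ε j - inner ℝ (X j) β) + τ / 2 * ‖β‖ ^ 2

/-- The regression vector computed from all the observations. -/
def betaHat : EuclideanSpace ℝ (Fin p) :=
  argMin (objective ρ τ X ε Finset.univ)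

/-- The leave-one-out regression vector: observation `i` is not used. -/
def betaLoo (i : Fin n) : EuclideanSpace ℝ (Fin p) :=
  argMin (objective ρ τ X ε (Finset.univ.erase i))

/-- The residuals `R_i` of the full regression. -/
def resid (i : Fin n) : ℝ :=
  ε i - inner ℝ (X i) (betaHat ρ τ X ε)

/-- The residual `r_{j,(i)}` of observation `j` in the regression that leaves out `i`. -/
def residLoo (i j : Fin n) : ℝ :=
  ε j - inner ℝ (X j) (betaLoo ρ τ X ε i)

/-- `S_i = (1/n) ∑_{j ≠ i} ρ''(r_{j,(i)}) X_j X_jᵀ`. -/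
def matS (i : Fin n) : Matrix (Fin p) (Fin p) ℝ :=
  (1 / (n : ℝ)) • ∑ j ∈ Finset.univ.erase i,
    deriv (deriv ρ) (residLoo ρ τ X ε i j) •
      Matrix.vecMulVec (WithLp.ofLp (X j)) (WithLp.ofLp (X j))

/-- The vector `(S_i + τ I)⁻¹ X_i`. -/
def resolventX (i : Fin n) : EuclideanSpace ℝ (Fin p) :=
  WithLp.toLp 2 (Matrix.mulVec ((matS ρ τ X ε i + τ • (1 : Matrix (Fin p) (Fin p) ℝ))⁻¹)
    (WithLp.ofLp (X i)))

/-- `c_i = (1/n) X_iᵀ (S_i + τ I)⁻¹ X_i`. -/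
def cLoo (i : Fin n) : ℝ :=
  (1 / (n : ℝ)) * inner ℝ (X i) (resolventX ρ τ X ε i)

/-- `prox_{c_i}(ρ)(r_{i,(i)})`. -/
def proxResid (i : Fin n) : ℝ :=
  prox ρ (cLoo ρ τ X ε i) (residLoo ρ τ X ε i i)

/-- The leave-one-out approximation of `betaHat`. -/
def betaTilde (i : Fin n) : EuclideanSpace ℝ (Fin p) :=
  betaLoo ρ τ X ε i +
    ((1 / (n : ℝ)) * deriv ρ (proxResid ρ τ X ε i)) • resolventX ρ τ X ε i

end Estimators

section Orders

variable {Ω : ℕ → Type*} [∀ n, MeasurableSpace (Ω n)]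

/-- `Z n = O_{L_k}(r n)`: the `L_k` norm of the random variable `Z n` is at most `K * r n` for all
large `n`, with `K` independent of `n`. -/
def BigOLk (P : ∀ n, Measure (Ω n)) (k : ℕ) (Z : ∀ n, Ω n → ℝ) (r : ℕ → ℝ) : Prop :=
  ∃ K : ℝ, ∀ᶠ n in atTop,
    MemLp (Z n) k (P n) ∧ eLpNorm (Z n) k (P n) ≤ ENNReal.ofReal (K * r n)

/-- `Z n i = O_{L_k}(r n)` with a constant that depends neither on `n` nor on the index `i`. -/
def BigOLkUnif (P : ∀ n, Measure (Ω n)) (k : ℕ) (Z : ∀ n, Fin n → Ω n → ℝ) (r : ℕ → ℝ) : Prop :=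
  ∃ K : ℝ, ∀ᶠ n in atTop, ∀ i : Fin n,
    MemLp (Z n i) k (P n) ∧ eLpNorm (Z n i) k (P n) ≤ ENNReal.ofReal (K * r n)

end Orders

/-- The loss is twice differentiable, convex, nonlinear, nonnegative and vanishes at `0`. -/
structure IsLoss (ρ : ℝ → ℝ) : Prop where
  differentiable : Differentiable ℝ ρ
  differentiable_deriv : Differentiable ℝ (deriv ρ)
  convex : ConvexOn ℝ univ ρ
  nonlinear : ¬ ∃ a : ℝ, ∀ x, ρ x = a * x
  nonneg : ∀ x, 0 ≤ ρ x
  zero : ρ 0 = 0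

/-- `ψ = ρ'` grows at most polynomially, and `ψ'` is `L(u)`-Lipschitz on `(-u, u)` where `L` grows
at most polynomially. -/
structure LossGrowth (ρ : ℝ → ℝ) : Prop where
  deriv_growth : ∃ m : ℝ, (fun x : ℝ => deriv ρ |x|) =O[cocompact ℝ] fun x : ℝ => |x| ^ m
  deriv2_lipschitz : ∃ (L : ℝ → ℝ) (K m₁ : ℝ),
    (∀ u > 0, ∀ x ∈ Ioo (-u) u, ∀ y ∈ Ioo (-u) u,
      |deriv (deriv ρ) x - deriv (deriv ρ) y| ≤ L u * |x - y|) ∧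
    ∀ᶠ u in atTop, L u ≤ K * u ^ m₁

section Array

variable {Ω : ℕ → Type*} [∀ n, MeasurableSpace (Ω n)]

/-- In each row the `X_i` are i.i.d., centered, with identity covariance, and convex `1`-Lipschitz
functions of them concentrate at a Gaussian rate around a deterministic value (such as their
median or mean). Both `1 / c_n` and `log C_n` grow at most like a power of `log n`. -/
structure IsDesign (P : ∀ n, Measure (Ω n)) (p : ℕ → ℕ)
    (X : ∀ n, Fin n → Ω n → EuclideanSpace ℝ (Fin (p n))) : Prop where
  measurable : ∀ n i, Measurable (X n i)
  indep : ∀ n, iIndepFun (X n) (P n)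
  identDistrib : ∀ n i j, IdentDistrib (X n i) (X n j) (P n) (P n)
  memLp : ∀ n i, MemLp (X n i) 2 (P n)
  mean : ∀ n i a, ∫ ω, X n i ω a ∂(P n) = 0
  cov : ∀ n i a b, covariance (fun ω => X n i ω a) (fun ω => X n i ω b) (P n)
    = if a = b then 1 else 0
  concentration : ∃ C c : ℕ → ℝ,
    (∀ n, 0 < c n) ∧
    (∃ α : ℝ, 0 ≤ α ∧ (fun n => (c n)⁻¹) =O[atTop] fun n => Real.log n ^ α) ∧
    (∃ K α' : ℝ, ∀ᶠ n : ℕ in atTop, C n ≤ Real.exp (K * Real.log n ^ α')) ∧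
    ∀ n, ∀ F : EuclideanSpace ℝ (Fin (p n)) → ℝ, LipschitzWith 1 F → ConvexOn ℝ univ F →
      ∀ i, ∃ m : ℝ, ∀ t > 0,
        (P n).real {ω | t < |F (X n i ω) - m|} ≤ C n * Real.exp (-(c n) * t ^ 2)

/-- In each row the errors are independent; the moments of `ψ(ε_i)` are bounded on average over
`i`; and the largest error is of order a power of `log n` in every `L_k`. -/
structure IsErrors (P : ∀ n, Measure (Ω n)) (ρ : ℝ → ℝ) (ε : ∀ n, Fin n → Ω n → ℝ) : Prop where
  measurable : ∀ n i, Measurable (ε n i)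
  indep : ∀ n, iIndepFun (ε n) (P n)
  moments : ∀ k : ℕ, ∃ B : ℝ, ∀ᶠ n : ℕ in atTop,
    (∀ i, Integrable (fun ω => deriv ρ (ε n i ω) ^ (2 * k)) (P n)) ∧
    (1 / (n : ℝ)) * ∑ i, ∫ ω, deriv ρ (ε n i ω) ^ (2 * k) ∂(P n) ≤ B
  sup_size : ∃ b : ℝ, ∀ k : ℕ, 1 ≤ k →
    BigOLk P k (fun n ω => ⨆ i, |ε n i ω|) fun n => Real.log n ^ b

end Array

end RobustRidge

end

/-! The ridge term makes every objective `τ`-strongly convex, so the distance from a point to the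
minimizer is at most the norm of the gradient at that point divided by `τ` (`norm_sub_argMin_le`).
The heart of the proof applies this at β̃_i. The prox is chosen so that the i-th residual of β̃_i is
exactly prox_{c_i}(ρ)(r̃_{i,(i)}), and the correction η = β̃_i - β̂_(i) solves (S_i + τ)η = ψ(prox)
X_i / n. Together with the stationarity of β̂_(i), this cancels all terms of order zero and one, and
the gradient is an average of vectors X_j weighted by second-order Taylor remainders of ψ
(`grad_betaTilde`). The remainders are quadratic in X_jᵀη. By symmetry of the resolvent, X_jᵀη =
ψ(prox) X_iᵀ(S_i + τ)⁻¹X_j / n, where X_i is independent of (S_i + τ)⁻¹X_j; hence X_jᵀη is of order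
n^{-1/2} up to logarithms, a factor √n better than Cauchy-Schwarz gives, and the gradient is of
order 1/n.

Probability and analysis are separated by `DataBound`: one number T ≥ 1 bounds the errors, the Gram
form divided by n, and X_i tested against leave-one-out vectors. Under it every error is at most a
polynomial in T times the right power of n (`exists_polyBdd_error`), simultaneously for all i and j,
so the suprema cost nothing.

A random T is built in `exists_dataBound`. Concentration of the linear functionals, with the
identity covariance, gives exponential moments of (X_iᵀu)² for ‖u‖ ≤ 1, and independence allows u to
be any function of the other data. The logarithm of a sum of such exponentials dominates their
maximum: over n + n² leave-one-out products it has logarithmic size, and over a net of 5^p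
directions for the Gram form it has size n up to logarithms because p/n is bounded. So all moments
of T are powers of log n with one exponent for every L_k, and a polynomial of T inherits this. -/

noncomputable section

namespace RobustRidge

/-! ### The loss -/

/-- A loss whose second derivative is Lipschitz with an explicit polynomial modulus. -/
structure IsPolyLoss (ρ : ℝ → ℝ) (D : ℝ) (M : ℕ) : Prop where
  isLoss : IsLoss ρ
  nonneg : 0 ≤ D
  lipschitz : ∀ x y, |deriv (deriv ρ) x - deriv (deriv ρ) y| ≤ D * (1 + |x| + |y|) ^ M * |x - y|

theorem exists_isPolyLoss {ρ : ℝ → ℝ} (hρ : IsLoss ρ) (hg : LossGrowth ρ) :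
    ∃ D M, IsPolyLoss ρ D M := by
  obtain ⟨L, K, m, hL, hK⟩ := hg.deriv2_lipschitz
  obtain ⟨U, hU⟩ := eventually_atTop.1 hK
  set V := max U 0 with hV
  have hV0 : 0 ≤ V := le_max_right _ _
  set M := ⌈|m|⌉₊ with hM
  refine ⟨|K| * (V + 1) ^ M, M, hρ, by positivity, fun x y => ?_⟩
  set s := |x| + |y| with hs
  have hx : 0 ≤ |x| := abs_nonneg x
  have hy : 0 ≤ |y| := abs_nonneg y
  -- This radius puts both points inside (-u, u) and exceeds the threshold beyond which the
  -- polynomial bound on the Lipschitz constant is valid.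
  set u := V + 1 + s with hu
  have hu1 : 1 ≤ u := by simp only [hu, hs]; linarith
  have h1 := hL u (by linarith) x (abs_lt.1 (by simp only [hu, hs]; linarith)) y
    (abs_lt.1 (by simp only [hu, hs]; linarith))
  refine h1.trans (mul_le_mul_of_nonneg_right ?_ (abs_nonneg _))
  have h2 : L u ≤ K * u ^ m := hU u ((le_max_left U 0).trans (by simp only [hu, hs]; linarith))
  have h3 : u ^ m ≤ u ^ M := by
    rw [← Real.rpow_natCast]
    exact Real.rpow_le_rpow_of_exponent_le hu1 ((le_abs_self m).trans (Nat.le_ceil _))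
  have h4 : u ≤ (V + 1) * (1 + |x| + |y|) := by simp only [hu, hs]; nlinarith
  calc L u ≤ K * u ^ m := h2
    _ ≤ |K| * u ^ m := mul_le_mul_of_nonneg_right (le_abs_self K) (by positivity)
    _ ≤ |K| * u ^ M := by gcongr
    _ ≤ |K| * ((V + 1) * (1 + |x| + |y|)) ^ M := by gcongr
    _ = _ := by rw [mul_pow]; ring

namespace IsLoss

variable {ρ : ℝ → ℝ} (hρ : IsLoss ρ)
include hρ

theorem monotone_deriv : Monotone (deriv ρ) := by
  have := hρ.convex.monotoneOn_deriv (fun x _ => hρ.differentiable x)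
  exact fun x y h => this (mem_univ x) (mem_univ y) h

theorem deriv_zero : deriv ρ 0 = 0 := by
  have : IsLocalMin ρ 0 := Eventually.of_forall fun x => by rw [hρ.zero]; exact hρ.nonneg x
  exact this.deriv_eq_zero

theorem deriv2_nonneg (x : ℝ) : 0 ≤ deriv (deriv ρ) x := hρ.monotone_deriv.deriv_nonneg

theorem continuous_deriv : Continuous (deriv ρ) := hρ.differentiable_deriv.continuous

theorem mul_sub_nonneg (x y : ℝ) : 0 ≤ (deriv ρ x - deriv ρ y) * (x - y) := by
  rcases le_total x y with h | h
  · exact mul_nonneg_of_nonpos_of_nonpos (sub_nonpos.2 (hρ.monotone_deriv h)) (sub_nonpos.2 h)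
  · exact mul_nonneg (sub_nonneg.2 (hρ.monotone_deriv h)) (sub_nonneg.2 h)

/-- Since ψ is monotone and vanishes at 0, it has the sign of its argument, so the hypothesis places
y on the side of x away from 0. It serves both for the prox and for the full residual. -/
theorem abs_le_of_mul_sub_nonneg {x y : ℝ} (h : 0 ≤ deriv ρ x * (y - x))
    (h0 : deriv ρ x = 0 → x = y) : |x| ≤ |y| := by
  rcases lt_trichotomy (deriv ρ x) 0 with hx | hx | hx
  · have h1 : y ≤ x := by nlinarith
    have h2 : x ≤ 0 := by
      by_contra! hc
      have := hρ.monotone_deriv hc.le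
      rw [hρ.deriv_zero] at this
      linarith
    rw [abs_of_nonpos h2, abs_of_nonpos (h1.trans h2)]; linarith
  · rw [h0 hx]
  · have h1 : x ≤ y := by nlinarith
    have h2 : 0 ≤ x := by
      by_contra! hc
      have := hρ.monotone_deriv hc.le
      rw [hρ.deriv_zero] at this
      linarith
    rw [abs_of_nonneg h2, abs_of_nonneg (h2.trans h1)]; exact h1

end IsLoss

namespace IsPolyLoss

variable {ρ : ℝ → ℝ} {D : ℝ} {M : ℕ} (hρ : IsPolyLoss ρ D M)
include hρ

theorem continuous_deriv2 : Continuous (deriv (deriv ρ)) := by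
  rw [continuous_iff_continuousAt]
  intro y
  rw [ContinuousAt, tendsto_iff_norm_sub_tendsto_zero]
  have : Tendsto (fun x => D * (1 + |x| + |y|) ^ M * |x - y|) (𝓝 y) (𝓝 0) := by
    have hc : Continuous fun x : ℝ => D * (1 + |x| + |y|) ^ M * |x - y| := by fun_prop
    simpa using hc.tendsto y
  exact squeeze_zero (fun _ => norm_nonneg _) (fun x => hρ.lipschitz x y) this

theorem abs_deriv2_le (x : ℝ) :
    |deriv (deriv ρ) x| ≤ (|deriv (deriv ρ) 0| + D) * (1 + |x|) ^ (M + 1) := by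
  have h1 := hρ.lipschitz x 0
  simp only [abs_zero, add_zero, sub_zero] at h1
  have h2 : |deriv (deriv ρ) x| ≤ |deriv (deriv ρ) 0| + |deriv (deriv ρ) x - deriv (deriv ρ) 0| := by
    have := abs_add_le (deriv (deriv ρ) 0) (deriv (deriv ρ) x - deriv (deriv ρ) 0)
    simpa using this
  have h3 : (1:ℝ) ≤ (1 + |x|) ^ (M + 1) := one_le_pow₀ (by linarith [abs_nonneg x])
  have h4 : D * (1 + |x|) ^ M * |x| ≤ D * (1 + |x|) ^ (M + 1) := by
    rw [pow_succ, mul_assoc]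
    have := hρ.nonneg
    gcongr
    linarith
  nlinarith [abs_nonneg (deriv (deriv ρ) 0)]

theorem abs_deriv_le (x : ℝ) :
    |deriv ρ x| ≤ (|deriv (deriv ρ) 0| + D) * (1 + |x|) ^ (M + 2) := by
  have hD := hρ.nonneg
  have h := Convex.norm_image_sub_le_of_norm_deriv_le (f := deriv ρ) (x := 0) (y := x)
    (s := Icc (-|x|) |x|) (C := (|deriv (deriv ρ) 0| + D) * (1 + |x|) ^ (M + 1))
    (fun t _ => hρ.isLoss.differentiable_deriv t)
    (fun t ht => (hρ.abs_deriv2_le t).trans (by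
      have : |t| ≤ |x| := abs_le.2 ht
      gcongr)) (convex_Icc _ _) (by simp) (abs_le.1 le_rfl)
  simp only [hρ.isLoss.deriv_zero, sub_zero, Real.norm_eq_abs] at h
  refine h.trans ?_
  rw [pow_succ _ (M + 1), ← mul_assoc]
  gcongr
  linarith

/-- Mean value inequality for t ↦ ψ(t) - ψ'(r) t on the interval of radius |h| about r, where the
Lipschitz bound makes the derivative O(|h|). -/
theorem abs_taylor_le (r h : ℝ) :
    |deriv ρ (r - h) - deriv ρ r + deriv (deriv ρ) r * h|
      ≤ D * (1 + 2 * |r| + |h|) ^ M * h ^ 2 := by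
  have hD := hρ.nonneg
  have hd : ∀ t, HasDerivAt (fun t => deriv ρ t - deriv (deriv ρ) r * t)
      (deriv (deriv ρ) t - deriv (deriv ρ) r) t := fun t => by
    simpa using (hρ.isLoss.differentiable_deriv t).hasDerivAt.fun_sub
      ((hasDerivAt_id t).const_mul (deriv (deriv ρ) r))
  have hm := Convex.norm_image_sub_le_of_norm_hasDerivWithin_le
    (f := fun t => deriv ρ t - deriv (deriv ρ) r * t) (x := r) (y := r - h)
    (s := Icc (r - |h|) (r + |h|)) (C := D * (1 + 2 * |r| + |h|) ^ M * |h|)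
    (fun t _ => (hd t).hasDerivWithinAt) (fun t ht => (hρ.lipschitz t r).trans (by
      have h1 : |t - r| ≤ |h| := abs_le.2 ⟨by linarith [ht.1], by linarith [ht.2]⟩
      have h2 : |t| ≤ |r| + |h| := by
        have := abs_add_le (t - r) r
        simp only [sub_add_cancel] at this
        linarith
      have h3 : 1 + |t| + |r| ≤ 1 + 2 * |r| + |h| := by linarith
      gcongr)) (convex_Icc _ _) (by simp) (by
        constructor <;> [linarith [le_abs_self h]; linarith [neg_abs_le h]])
  simp only [Real.norm_eq_abs] at hm
  have e1 : deriv ρ (r - h) - deriv (deriv ρ) r * (r - h) - (deriv ρ r - deriv (deriv ρ) r * r)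
      = deriv ρ (r - h) - deriv ρ r + deriv (deriv ρ) r * h := by ring
  have e2 : |r - h - r| = |h| := by rw [show r - h - r = -h by ring, abs_neg]
  rw [e1, e2] at hm
  refine hm.trans_eq ?_
  rw [mul_assoc, ← sq, sq_abs]

end IsPolyLoss

/-! ### Minimizers -/

theorem argMin_le {E : Type*} [Nonempty E] {F : E → ℝ} (h : ∃ b, ∀ b', F b ≤ F b') (b : E) :
    F (argMin F) ≤ F b := Classical.epsilon_spec h b

section Gradient

variable {n p : ℕ} {ρ : ℝ → ℝ} {τ : ℝ}

/-- The gradient of `objective`. -/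
def grad (ρ : ℝ → ℝ) (τ : ℝ) (X : Fin n → EuclideanSpace ℝ (Fin p)) (ε : Fin n → ℝ)
    (s : Finset (Fin n)) (β : EuclideanSpace ℝ (Fin p)) : EuclideanSpace ℝ (Fin p) :=
  τ • β - (1 / (n : ℝ)) • ∑ j ∈ s, deriv ρ (ε j - inner ℝ (X j) β) • X j

variable (X : Fin n → EuclideanSpace ℝ (Fin p)) (ε : Fin n → ℝ) (s : Finset (Fin n))

theorem exists_minimizer_objective (hρ : IsLoss ρ) (hτ : 0 < τ) :
    ∃ b, ∀ b', objective ρ τ X ε s b ≤ objective ρ τ X ε s b' := by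
  have hc : Continuous (objective ρ τ X ε s) := by
    have := hρ.differentiable.continuous
    unfold objective
    fun_prop
  refine hc.exists_forall_le ?_
  refine tendsto_atTop_mono (f := fun β => τ / 2 * ‖β‖ ^ 2) (fun β => ?_) ?_
  · have : 0 ≤ (1 / (n : ℝ)) * ∑ j ∈ s, ρ (ε j - inner ℝ (X j) β) :=
      mul_nonneg (by positivity) (Finset.sum_nonneg fun j _ => hρ.nonneg _)
    unfold objective; linarith
  · exact ((tendsto_pow_atTop two_ne_zero).comp
      (tendsto_norm_cocompact_atTop)).const_mul_atTop (by positivity)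

theorem hasDerivAt_objective (hρ : IsLoss ρ) (b v : EuclideanSpace ℝ (Fin p)) :
    HasDerivAt (fun t : ℝ => objective ρ τ X ε s (b + t • v))
      (inner ℝ (grad ρ τ X ε s b) v) 0 := by
  have h1 : ∀ j ∈ s, HasDerivAt (fun t : ℝ => ρ (ε j - inner ℝ (X j) (b + t • v)))
      (deriv ρ (ε j - inner ℝ (X j) b) * (-(inner ℝ (X j) v))) 0 := fun j _ => by
    have hl : HasDerivAt (fun t : ℝ => ε j - inner ℝ (X j) (b + t • v)) (-(inner ℝ (X j) v)) 0 := by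
      have : (fun t : ℝ => ε j - inner ℝ (X j) (b + t • v))
          = fun t : ℝ => (ε j - inner ℝ (X j) b) - t * inner ℝ (X j) v := by
        funext t; rw [inner_add_right, inner_smul_right]; ring
      rw [this]
      simpa using ((hasDerivAt_id (0:ℝ)).mul_const (inner ℝ (X j) v)).const_sub
        (ε j - inner ℝ (X j) b)
    have h0 : HasDerivAt ρ (deriv ρ (ε j - inner ℝ (X j) b))
        (ε j - inner ℝ (X j) (b + (0:ℝ) • v)) := by
      simpa using (hρ.differentiable (ε j - inner ℝ (X j) b)).hasDerivAt
    exact h0.comp 0 hl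
  have h2 : HasDerivAt (fun t : ℝ => ‖b + t • v‖ ^ 2) (2 * inner ℝ b v) 0 := by
    have : (fun t : ℝ => ‖b + t • v‖ ^ 2)
        = fun t : ℝ => ‖b‖ ^ 2 + (t * (2 * inner ℝ b v) + t ^ 2 * ‖v‖ ^ 2) := by
      funext t
      rw [norm_add_sq_real, inner_smul_right, norm_smul, mul_pow, Real.norm_eq_abs, sq_abs]; ring
    rw [this]
    have := (((hasDerivAt_id (0:ℝ)).mul_const (2 * inner ℝ b v)).add
      ((hasDerivAt_pow 2 (0:ℝ)).mul_const (‖v‖ ^ 2))).const_add (‖b‖ ^ 2)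
    simpa using this
  have h3 := ((HasDerivAt.fun_sum h1).const_mul (1 / (n : ℝ))).add (h2.const_mul (τ / 2))
  refine h3.congr_deriv ?_
  simp only [grad, inner_sub_left, inner_smul_left, sum_inner, conj_trivial, mul_neg,
    Finset.sum_neg_distrib]
  ring

theorem grad_argMin (hρ : IsLoss ρ) (hτ : 0 < τ) :
    grad ρ τ X ε s (argMin (objective ρ τ X ε s)) = 0 := by
  set b := argMin (objective ρ τ X ε s)
  have h := hasDerivAt_objective (τ := τ) X ε s hρ b (grad ρ τ X ε s b)
  have hm : IsLocalMin (fun t : ℝ => objective ρ τ X ε s (b + t • grad ρ τ X ε s b)) 0 :=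
    Eventually.of_forall fun t => by
      simpa using argMin_le (exists_minimizer_objective X ε s hρ hτ) _
  have := hm.hasDerivAt_eq_zero h
  simpa using this

/-- The loss contributes a nonnegative term because ψ is monotone; the ridge term contributes
exactly the left side. -/
theorem mul_norm_sq_le_inner_grad (hρ : IsLoss ρ) (b b' : EuclideanSpace ℝ (Fin p)) :
    τ * ‖b - b'‖ ^ 2 ≤ inner ℝ (grad ρ τ X ε s b - grad ρ τ X ε s b') (b - b') := by
  have e : grad ρ τ X ε s b - grad ρ τ X ε s b' = τ • (b - b') - (1 / (n : ℝ)) •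
      ∑ j ∈ s, (deriv ρ (ε j - inner ℝ (X j) b) - deriv ρ (ε j - inner ℝ (X j) b')) • X j := by
    simp only [grad, sub_smul, Finset.sum_sub_distrib, smul_sub]
    abel
  rw [e, inner_sub_left, inner_smul_left, inner_smul_left, real_inner_self_eq_norm_sq, sum_inner]
  simp only [conj_trivial]
  have : ∑ j ∈ s, inner ℝ ((deriv ρ (ε j - inner ℝ (X j) b)
      - deriv ρ (ε j - inner ℝ (X j) b')) • X j) (b - b') ≤ 0 := by
    refine Finset.sum_nonpos fun j _ => ?_
    rw [inner_smul_left, conj_trivial, inner_sub_right]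
    have := hρ.mul_sub_nonneg (ε j - inner ℝ (X j) b) (ε j - inner ℝ (X j) b')
    nlinarith
  have h2 : (1 / (n : ℝ)) * ∑ j ∈ s, inner ℝ ((deriv ρ (ε j - inner ℝ (X j) b)
      - deriv ρ (ε j - inner ℝ (X j) b')) • X j) (b - b') ≤ 0 :=
    mul_nonpos_of_nonneg_of_nonpos (by positivity) this
  linarith

/-- Strong monotonicity against the minimizer, whose gradient is zero, then Cauchy-Schwarz. This a
posteriori bound gives the size of β̂_(i), the effect of one observation, the error of β̃_i, and the
continuity of the estimators in the data. -/
theorem norm_sub_argMin_le (hρ : IsLoss ρ) (hτ : 0 < τ) (b : EuclideanSpace ℝ (Fin p)) :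
    ‖b - argMin (objective ρ τ X ε s)‖ ≤ ‖grad ρ τ X ε s b‖ / τ := by
  set b' := argMin (objective ρ τ X ε s) with hb
  have h := mul_norm_sq_le_inner_grad (τ := τ) X ε s hρ b b'
  rw [hb, grad_argMin X ε s hρ hτ, sub_zero, ← hb] at h
  have h2 := h.trans (real_inner_le_norm _ _)
  rw [le_div_iff₀ hτ]
  rcases (norm_nonneg (b - b')).eq_or_lt with h0 | h0
  · rw [← h0]; simp
  · refine le_of_mul_le_mul_right ?_ h0
    nlinarith

end Gradient

/-! ### The proximal mapping -/

section Prox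

variable {ρ : ℝ → ℝ} {c : ℝ}

theorem prox_add (hρ : IsLoss ρ) (hc : 0 ≤ c) (x : ℝ) :
    prox ρ c x + c * deriv ρ (prox ρ c x) = x := by
  have hex : ∃ b, ∀ b', c * ρ b + (x - b) ^ 2 / 2 ≤ c * ρ b' + (x - b') ^ 2 / 2 := by
    have hcont : Continuous fun y => c * ρ y + (x - y) ^ 2 / 2 := by
      have := hρ.differentiable.continuous
      fun_prop
    refine hcont.exists_forall_le ?_
    refine tendsto_atTop_mono (f := fun y => ‖y - x‖ ^ 2 * (1 / 2)) (fun y => ?_) ?_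
    · have := mul_nonneg hc (hρ.nonneg y)
      rw [Real.norm_eq_abs, sq_abs]
      nlinarith
    · refine ((tendsto_pow_atTop two_ne_zero).comp ?_).atTop_mul_const (by norm_num)
      exact (tendsto_norm_cocompact_atTop).comp
        (Homeomorph.subRight x).isClosedEmbedding.tendsto_cocompact
  have hle : ∀ y, c * ρ (prox ρ c x) + (x - prox ρ c x) ^ 2 / 2 ≤ c * ρ y + (x - y) ^ 2 / 2 :=
    fun y => argMin_le hex y
  set y := prox ρ c x
  have hd : HasDerivAt (fun y => c * ρ y + (x - y) ^ 2 / 2) (c * deriv ρ y - (x - y)) y := by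
    have h1 := ((hρ.differentiable y).hasDerivAt.const_mul c).add
      ((((hasDerivAt_id y).const_sub x).pow 2).div_const 2)
    refine h1.congr_deriv ?_
    simp
    ring
  have hm : IsLocalMin (fun y => c * ρ y + (x - y) ^ 2 / 2) y := Eventually.of_forall hle
  have := hm.hasDerivAt_eq_zero hd
  linarith

theorem abs_prox_le (hρ : IsLoss ρ) (hc : 0 ≤ c) (x : ℝ) : |prox ρ c x| ≤ |x| := by
  have h := prox_add hρ hc x
  refine hρ.abs_le_of_mul_sub_nonneg ?_ fun h0 => by rw [h0] at h; simpa using h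
  have : x - prox ρ c x = c * deriv ρ (prox ρ c x) := by linarith
  rw [this]
  nlinarith [mul_nonneg hc (mul_self_nonneg (deriv ρ (prox ρ c x)))]

/-- The prox inverts y ↦ y + c ψ(y), which is expansive because ψ is monotone. Continuity of the
prox residual in the data rests on this. -/
theorem abs_sub_prox_le (hρ : IsLoss ρ) (hc : 0 ≤ c) (x y : ℝ) :
    |y - prox ρ c x| ≤ |y + c * deriv ρ y - x| := by
  have h := prox_add hρ hc x
  set z := prox ρ c x
  have h1 := hρ.mul_sub_nonneg y z
  have e : y + c * deriv ρ y - x = (y - z) + c * (deriv ρ y - deriv ρ z) := by linear_combination h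
  rw [e]
  refine sq_le_sq.1 ?_
  nlinarith [mul_nonneg hc h1, sq_nonneg (c * (deriv ρ y - deriv ρ z))]

end Prox

/-! ### The resolvent of `S_i` -/

section Resolvent

variable {n p : ℕ} {ρ : ℝ → ℝ} {τ : ℝ}

/-- The vector `(S_i + τ I)⁻¹ x`. -/
def resolvent (ρ : ℝ → ℝ) (τ : ℝ) (X : Fin n → EuclideanSpace ℝ (Fin p)) (ε : Fin n → ℝ)
    (i : Fin n) (x : EuclideanSpace ℝ (Fin p)) : EuclideanSpace ℝ (Fin p) :=
  WithLp.toLp 2 (Matrix.mulVec ((matS ρ τ X ε i + τ • (1 : Matrix (Fin p) (Fin p) ℝ))⁻¹)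
    (WithLp.ofLp x))

/-- The vector `(S_i + τ I) w`. -/
def shiftedS (ρ : ℝ → ℝ) (τ : ℝ) (X : Fin n → EuclideanSpace ℝ (Fin p)) (ε : Fin n → ℝ)
    (i : Fin n) (w : EuclideanSpace ℝ (Fin p)) : EuclideanSpace ℝ (Fin p) :=
  (1 / (n : ℝ)) • ∑ j ∈ Finset.univ.erase i,
    (deriv (deriv ρ) (residLoo ρ τ X ε i j) * inner ℝ (X j) w) • X j + τ • w

variable (X : Fin n → EuclideanSpace ℝ (Fin p)) (ε : Fin n → ℝ) (i : Fin n)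

/-- From here on the matrix is handled as a symmetric coercive operator; the matrix inverse enters
only through `isUnit_det_matS`. -/
theorem matS_mulVec (w : EuclideanSpace ℝ (Fin p)) :
    WithLp.toLp 2 (Matrix.mulVec (matS ρ τ X ε i + τ • (1 : Matrix (Fin p) (Fin p) ℝ))
      (WithLp.ofLp w)) = shiftedS ρ τ X ε i w := by
  have hin : ∀ j, (WithLp.ofLp (X j)) ⬝ᵥ (WithLp.ofLp w) = inner ℝ (X j) w := fun j => by
    rw [EuclideanSpace.inner_eq_star_dotProduct, dotProduct_comm]
    simp
  simp only [shiftedS, matS, Matrix.add_mulVec, Matrix.smul_mulVec, Matrix.one_mulVec,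
    Matrix.sum_mulVec, Matrix.vecMulVec_mulVec, hin]
  ext a
  simp [mul_comm, mul_left_comm]

theorem mul_norm_sq_le_inner_shiftedS (hρ : IsLoss ρ) (w : EuclideanSpace ℝ (Fin p)) :
    τ * ‖w‖ ^ 2 ≤ inner ℝ (shiftedS ρ τ X ε i w) w := by
  rw [shiftedS, inner_add_left, inner_smul_left, inner_smul_left, sum_inner,
    real_inner_self_eq_norm_sq]
  simp only [conj_trivial, inner_smul_left]
  have : 0 ≤ (1 / (n : ℝ)) * ∑ j ∈ Finset.univ.erase i,
      deriv (deriv ρ) (residLoo ρ τ X ε i j) * inner ℝ (X j) w * inner ℝ (X j) w := by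
    refine mul_nonneg (by positivity) (Finset.sum_nonneg fun j _ => ?_)
    rw [mul_assoc]
    exact mul_nonneg (hρ.deriv2_nonneg _) (mul_self_nonneg _)
  linarith

theorem inner_shiftedS_comm (v w : EuclideanSpace ℝ (Fin p)) :
    inner ℝ (shiftedS ρ τ X ε i v) w = inner ℝ v (shiftedS ρ τ X ε i w) := by
  simp only [shiftedS, inner_add_left, inner_add_right, inner_smul_left, inner_smul_right,
    sum_inner, inner_sum, conj_trivial]
  congr 2
  refine Finset.sum_congr rfl fun j _ => ?_
  rw [real_inner_comm v (X j)]
  ring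

theorem isUnit_det_matS (hρ : IsLoss ρ) (hτ : 0 < τ) :
    IsUnit (matS ρ τ X ε i + τ • (1 : Matrix (Fin p) (Fin p) ℝ)).det := by
  rw [← Matrix.isUnit_iff_isUnit_det, ← Matrix.mulVec_injective_iff_isUnit]
  rw [← Matrix.coe_mulVecLin, ← LinearMap.ker_eq_bot, LinearMap.ker_eq_bot']
  intro m hm
  have h1 := matS_mulVec (ρ := ρ) (τ := τ) X ε i (WithLp.toLp 2 m)
  have h2 := mul_norm_sq_le_inner_shiftedS (τ := τ) X ε i hρ (WithLp.toLp 2 m)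
  rw [← h1] at h2
  simp only [Matrix.mulVecLin_apply] at hm
  rw [hm] at h2
  simp only [WithLp.toLp_zero, inner_zero_left] at h2
  have h3 : ‖WithLp.toLp 2 m‖ ^ 2 ≤ 0 := by
    by_contra! hc
    nlinarith
  have h4 : ‖WithLp.toLp 2 m‖ = 0 := by nlinarith [norm_nonneg (WithLp.toLp 2 m)]
  simpa using h4

theorem shiftedS_resolvent (hρ : IsLoss ρ) (hτ : 0 < τ) (x : EuclideanSpace ℝ (Fin p)) :
    shiftedS ρ τ X ε i (resolvent ρ τ X ε i x) = x := by
  rw [← matS_mulVec, resolvent]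
  simp only [Matrix.mulVec_mulVec]
  rw [Matrix.mul_nonsing_inv _ (isUnit_det_matS X ε i hρ hτ)]
  simp

theorem norm_resolvent_le (hρ : IsLoss ρ) (hτ : 0 < τ) (x : EuclideanSpace ℝ (Fin p)) :
    ‖resolvent ρ τ X ε i x‖ ≤ ‖x‖ / τ := by
  have h := mul_norm_sq_le_inner_shiftedS (τ := τ) X ε i hρ (resolvent ρ τ X ε i x)
  rw [shiftedS_resolvent X ε i hρ hτ] at h
  have h2 := h.trans (real_inner_le_norm _ _)
  rw [le_div_iff₀ hτ]
  rcases (norm_nonneg (resolvent ρ τ X ε i x)).eq_or_lt with h0 | h0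
  · rw [← h0]; simp
  · refine le_of_mul_le_mul_right ?_ h0
    nlinarith

theorem inner_resolvent_comm (hρ : IsLoss ρ) (hτ : 0 < τ) (x y : EuclideanSpace ℝ (Fin p)) :
    inner ℝ x (resolvent ρ τ X ε i y) = inner ℝ y (resolvent ρ τ X ε i x) := by
  conv_lhs => rw [← shiftedS_resolvent X ε i hρ hτ x]
  rw [inner_shiftedS_comm, shiftedS_resolvent X ε i hρ hτ, real_inner_comm]

theorem cLoo_nonneg (hρ : IsLoss ρ) (hτ : 0 < τ) : 0 ≤ cLoo ρ τ X ε i := by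
  have h := mul_norm_sq_le_inner_shiftedS (τ := τ) X ε i hρ (resolvent ρ τ X ε i (X i))
  rw [shiftedS_resolvent X ε i hρ hτ] at h
  exact mul_nonneg (by positivity) (le_trans (by positivity) h)

end Resolvent

/-! ### Deterministic bounds -/

/-- `f T` is nonnegative and at most polynomial in `T ≥ 1`. -/
def PolyBdd (f : ℝ → ℝ) : Prop :=
  ∃ (C : ℝ) (M : ℕ), 0 ≤ C ∧ ∀ T, 1 ≤ T → 0 ≤ f T ∧ f T ≤ C * T ^ M

namespace PolyBdd

variable {f g : ℝ → ℝ}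

theorem const {c : ℝ} (hc : 0 ≤ c) : PolyBdd fun _ => c :=
  ⟨c, 0, hc, fun T _ => ⟨hc, by simp⟩⟩

theorem id : PolyBdd fun T => T := ⟨1, 1, zero_le_one, fun T h => ⟨by linarith, by simp⟩⟩

theorem add (hf : PolyBdd f) (hg : PolyBdd g) : PolyBdd fun T => f T + g T := by
  obtain ⟨C, M, hC, h⟩ := hf
  obtain ⟨C', M', hC', h'⟩ := hg
  refine ⟨C + C', M + M', by positivity, fun T hT => ⟨add_nonneg (h T hT).1 (h' T hT).1, ?_⟩⟩
  have h1 : T ^ M ≤ T ^ (M + M') := pow_le_pow_right₀ hT (by omega)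
  have h2 : T ^ M' ≤ T ^ (M + M') := pow_le_pow_right₀ hT (by omega)
  rw [add_mul]
  exact add_le_add ((h T hT).2.trans (by gcongr)) ((h' T hT).2.trans (by gcongr))

theorem mul (hf : PolyBdd f) (hg : PolyBdd g) : PolyBdd fun T => f T * g T := by
  obtain ⟨C, M, hC, h⟩ := hf
  obtain ⟨C', M', hC', h'⟩ := hg
  refine ⟨C * C', M + M', by positivity, fun T hT => ⟨mul_nonneg (h T hT).1 (h' T hT).1, ?_⟩⟩
  calc f T * g T ≤ (C * T ^ M) * (C' * T ^ M') :=
        mul_le_mul (h T hT).2 (h' T hT).2 (h' T hT).1 ((h T hT).1.trans (h T hT).2)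
    _ = _ := by rw [pow_add]; ring

theorem pow (hf : PolyBdd f) (k : ℕ) : PolyBdd fun T => f T ^ k := by
  induction k with
  | zero => simpa using const zero_le_one
  | succ k ih => simpa only [pow_succ] using ih.mul hf

theorem div_const (hf : PolyBdd f) {c : ℝ} (hc : 0 < c) : PolyBdd fun T => f T / c := by
  simpa only [div_eq_mul_inv] using hf.mul (const (inv_nonneg.2 hc.le))

end PolyBdd

/-- The random quantities on which the leave-one-out error depends are bounded by `T`. -/
structure DataBound {n p : ℕ} (ρ : ℝ → ℝ) (τ : ℝ) (X : Fin n → EuclideanSpace ℝ (Fin p))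
    (ε : Fin n → ℝ) (T : ℝ) : Prop where
  one_le : 1 ≤ T
  eps : ∀ j, |ε j| ≤ T
  gram : ∀ u, ∑ j, inner ℝ (X j) u ^ 2 ≤ n * T * ‖u‖ ^ 2
  loo : ∀ i, |inner ℝ (X i) (betaLoo ρ τ X ε i)| ≤ T * ‖betaLoo ρ τ X ε i‖
  res : ∀ i j, j ≠ i →
    |inner ℝ (X i) (resolvent ρ τ X ε i (X j))| ≤ T * ‖resolvent ρ τ X ε i (X j)‖

namespace DataBound

variable {n p : ℕ} {ρ : ℝ → ℝ} {τ T D : ℝ} {M : ℕ} {X : Fin n → EuclideanSpace ℝ (Fin p)}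
  {ε : Fin n → ℝ}

/-- Testing the Gram bound on u = X_j gives ‖X_j‖⁴ ≤ nT‖X_j‖², and T ≤ T². -/
theorem norm_le (h : DataBound ρ τ X ε T) (j : Fin n) : ‖X j‖ ≤ √n * T := by
  have h1 := (Finset.single_le_sum (f := fun j' => inner ℝ (X j') (X j) ^ 2)
    (fun j' _ => sq_nonneg _) (Finset.mem_univ j)).trans (h.gram (X j))
  simp only [real_inner_self_eq_norm_sq] at h1
  have hT := h.one_le
  refine le_of_sq_le_sq ?_ (by positivity)
  rw [mul_pow, Real.sq_sqrt (Nat.cast_nonneg n)]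
  rcases (norm_nonneg (X j)).eq_or_lt with h0 | h0
  · rw [← h0, zero_pow two_ne_zero]; positivity
  · have h2 : ‖X j‖ ^ 2 ≤ n * T := le_of_mul_le_mul_right (by nlinarith) (pow_pos h0 2)
    have h3 : (0:ℝ) ≤ n := by positivity
    nlinarith [mul_nonneg h3 (by nlinarith : 0 ≤ T ^ 2 - T)]

/-- Duality: the average w is paired with itself, and Cauchy-Schwarz with the Gram bound controls ∑
|X_jᵀw| by nT‖w‖. Bounding each ‖X_j‖ separately would lose a factor √n. -/
theorem norm_avg_le (h : DataBound ρ τ X ε T) (s : Finset (Fin n)) (e : Fin n → ℝ) {m : ℝ}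
    (hm : 0 ≤ m) (he : ∀ j ∈ s, |e j| ≤ m) :
    ‖(1 / (n : ℝ)) • ∑ j ∈ s, e j • X j‖ ≤ m * T := by
  have hT := h.one_le
  set w := (1 / (n : ℝ)) • ∑ j ∈ s, e j • X j with hw
  have h1 : (∑ j, |inner ℝ (X j) w|) ≤ n * T * ‖w‖ := by
    refine le_of_sq_le_sq ?_ (by positivity)
    have := sq_sum_le_card_mul_sum_sq (s := Finset.univ) (f := fun j => |inner ℝ (X j) w|)
    simp only [Finset.card_univ, Fintype.card_fin, sq_abs] at this
    have h3 := mul_le_mul_of_nonneg_left (h.gram w) (Nat.cast_nonneg (α := ℝ) n)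
    have h4 : (n : ℝ) * (n * T * ‖w‖ ^ 2) ≤ (n * T * ‖w‖) ^ 2 := by
      have : 0 ≤ (T ^ 2 - T) * ((n : ℝ) ^ 2 * ‖w‖ ^ 2) :=
        mul_nonneg (by nlinarith) (by positivity)
      nlinarith
    linarith
  have h2 : ‖w‖ ^ 2 ≤ m * T * ‖w‖ := by
    have e0 : ∀ v, inner ℝ w v = 1 / (n : ℝ) * ∑ j ∈ s, e j * inner ℝ (X j) v := fun v => by
      rw [hw, inner_smul_left, sum_inner]
      simp only [conj_trivial, inner_smul_left]
    rw [← real_inner_self_eq_norm_sq, e0]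
    rcases Nat.eq_zero_or_pos n with h0 | h0
    · subst h0
      simp only [Nat.cast_zero, div_zero, zero_mul]
      positivity
    have hn : (0:ℝ) < n := by exact_mod_cast h0
    rw [one_div, inv_mul_le_iff₀ hn]
    calc ∑ j ∈ s, e j * inner ℝ (X j) w ≤ ∑ j ∈ s, m * |inner ℝ (X j) w| := by
          refine Finset.sum_le_sum fun j hj => (le_abs_self _).trans ?_
          rw [abs_mul]
          exact mul_le_mul_of_nonneg_right (he j hj) (abs_nonneg _)
      _ ≤ ∑ j, m * |inner ℝ (X j) w| :=
          Finset.sum_le_sum_of_subset_of_nonneg (Finset.subset_univ _)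
            fun j _ _ => mul_nonneg hm (abs_nonneg _)
      _ = m * ∑ j, |inner ℝ (X j) w| := by rw [Finset.mul_sum]
      _ ≤ m * (n * T * ‖w‖) := by gcongr
      _ = n * (m * T * ‖w‖) := by ring
  rcases (norm_nonneg w).eq_or_lt with h0 | h0
  · rw [← h0]; positivity
  · exact le_of_mul_le_mul_right (by nlinarith) h0

end DataBound

section Deterministic

variable {n p : ℕ} {ρ : ℝ → ℝ} {τ T D : ℝ} {M : ℕ} {X : Fin n → EuclideanSpace ℝ (Fin p)}
  {ε : Fin n → ℝ}

/-- Adding the observation `i` pulls its residual towards `0`. -/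
theorem abs_resid_le (hρ : IsLoss ρ) (hτ : 0 < τ) (i : Fin n) :
    |resid ρ τ X ε i| ≤ |residLoo ρ τ X ε i i| ∧
    ‖betaHat ρ τ X ε - betaLoo ρ τ X ε i‖
      ≤ 1 / n * |deriv ρ (resid ρ τ X ε i)| * ‖X i‖ / τ := by
  have hn : (0:ℝ) < n := by exact_mod_cast i.pos
  -- Stationarity of the full problem leaves only the i-th term. Strong monotonicity then shows that
  -- ψ(R_i)(r̃_{i,(i)} - R_i) is nonnegative.
  have hg : grad ρ τ X ε (Finset.univ.erase i) (betaHat ρ τ X ε)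
      = (1 / (n : ℝ)) • deriv ρ (resid ρ τ X ε i) • X i := by
    have h0 : grad ρ τ X ε Finset.univ (betaHat ρ τ X ε) = 0 :=
      grad_argMin X ε Finset.univ hρ hτ
    rw [grad, ← Finset.add_sum_erase _ _ (Finset.mem_univ i), smul_add] at h0
    rw [grad, resid]
    rw [sub_eq_zero] at h0
    rw [h0]
    abel
  have hb := norm_sub_argMin_le X ε (Finset.univ.erase i) hρ hτ (betaHat ρ τ X ε)
  have hm := mul_norm_sq_le_inner_grad (τ := τ) X ε (Finset.univ.erase i) hρ (betaHat ρ τ X ε)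
    (betaLoo ρ τ X ε i)
  have hz : grad ρ τ X ε (Finset.univ.erase i) (betaLoo ρ τ X ε i) = 0 :=
    grad_argMin X ε _ hρ hτ
  rw [hz, sub_zero, hg, inner_smul_left, inner_smul_left] at hm
  rw [hg] at hb
  change ‖betaHat ρ τ X ε - betaLoo ρ τ X ε i‖ ≤ _ at hb
  have hr : residLoo ρ τ X ε i i - resid ρ τ X ε i
      = inner ℝ (X i) (betaHat ρ τ X ε - betaLoo ρ τ X ε i) := by
    rw [inner_sub_right, residLoo, resid]; ring
  refine ⟨hρ.abs_le_of_mul_sub_nonneg ?_ fun h0 => ?_, ?_⟩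
  · rw [hr]
    simp only [conj_trivial] at hm
    have h1 : 0 ≤ 1 / (n : ℝ) * (deriv ρ (resid ρ τ X ε i) *
        inner ℝ (X i) (betaHat ρ τ X ε - betaLoo ρ τ X ε i)) := le_trans (by positivity) hm
    exact nonneg_of_mul_nonneg_right h1 (by positivity)
  · rw [h0] at hb
    simp only [zero_smul, smul_zero, norm_zero, zero_div] at hb
    have : betaHat ρ τ X ε - betaLoo ρ τ X ε i = 0 := norm_le_zero_iff.1 hb
    rw [this, inner_zero_right] at hr
    linarith
  · rw [norm_smul, norm_smul, Real.norm_eq_abs, Real.norm_eq_abs, abs_of_nonneg (by positivity),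
      ← mul_assoc] at hb
    exact hb

/-- The error of the gradient at `betaTilde` is of second order. -/
theorem grad_betaTilde (hρ : IsLoss ρ) (hτ : 0 < τ) (i : Fin n) :
    grad ρ τ X ε Finset.univ (betaTilde ρ τ X ε i) =
      (1 / (n : ℝ)) • ∑ j ∈ Finset.univ.erase i,
        (-(deriv ρ (residLoo ρ τ X ε i j
            - inner ℝ (X j) (betaTilde ρ τ X ε i - betaLoo ρ τ X ε i))
          - deriv ρ (residLoo ρ τ X ε i j) + deriv (deriv ρ) (residLoo ρ τ X ε i j)
            * inner ℝ (X j) (betaTilde ρ τ X ε i - betaLoo ρ τ X ε i))) • X j := by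
  have hr : ∀ j, ε j - inner ℝ (X j) (betaTilde ρ τ X ε i) = residLoo ρ τ X ε i j
      - inner ℝ (X j) (betaTilde ρ τ X ε i - betaLoo ρ τ X ε i) := fun j => by
    rw [inner_sub_right, residLoo]; ring
  have hη : betaTilde ρ τ X ε i - betaLoo ρ τ X ε i
      = ((1 / (n : ℝ)) * deriv ρ (proxResid ρ τ X ε i)) • resolventX ρ τ X ε i := by
    rw [betaTilde]; abel
  -- The prox equation with c_i = X_iᵀ(S_i + τ)⁻¹X_i / n makes this an equality, so observation i
  -- contributes no Taylor remainder.
  have hp : ε i - inner ℝ (X i) (betaTilde ρ τ X ε i) = proxResid ρ τ X ε i := by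
    have h := prox_add hρ (cLoo_nonneg X ε i hρ hτ) (residLoo ρ τ X ε i i)
    rw [hr, hη, inner_smul_right]
    rw [cLoo] at h
    simp only [proxResid, cLoo]
    linear_combination -h
  have hz : grad ρ τ X ε (Finset.univ.erase i) (betaLoo ρ τ X ε i) = 0 :=
    grad_argMin X ε _ hρ hτ
  have hs : shiftedS ρ τ X ε i (betaTilde ρ τ X ε i - betaLoo ρ τ X ε i)
      = ((1 / (n : ℝ)) * deriv ρ (proxResid ρ τ X ε i)) • X i := by
    have hlin : ∀ (c : ℝ) w, shiftedS ρ τ X ε i (c • w) = c • shiftedS ρ τ X ε i w := fun c w => by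
      simp only [shiftedS, inner_smul_right, smul_add, Finset.smul_sum, smul_smul]
      congr 1
      · refine Finset.sum_congr rfl fun j _ => ?_
        congr 1; ring
      · congr 1; ring
    rw [hη, hlin, show resolventX ρ τ X ε i = resolvent ρ τ X ε i (X i) from rfl,
      shiftedS_resolvent X ε i hρ hτ]
  rw [grad, ← Finset.add_sum_erase _ _ (Finset.mem_univ i), hp]
  simp only [hr]
  have hz' : τ • betaLoo ρ τ X ε i - (1 / (n : ℝ)) • ∑ j ∈ Finset.univ.erase i,
      deriv ρ (residLoo ρ τ X ε i j) • X j = 0 := hz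
  simp only [shiftedS] at hs
  set η := betaTilde ρ τ X ε i - betaLoo ρ τ X ε i with hηdef
  have hbt : betaTilde ρ τ X ε i = betaLoo ρ τ X ε i + η := by rw [hηdef]; abel
  rw [hbt, smul_add, smul_add, smul_smul, ← hs]
  simp only [neg_smul, add_smul, sub_smul, Finset.sum_neg_distrib, Finset.sum_add_distrib,
    Finset.sum_sub_distrib, smul_add, smul_sub, smul_neg]
  rw [sub_eq_zero] at hz'
  rw [hz']
  abel

set_option maxHeartbeats 1600000 in
/-- On data bounded by `T`, the leave-one-out approximation holds with errors polynomial in `T`. -/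
theorem exists_polyBdd_error (hρ : IsPolyLoss ρ D M) (hτ : 0 < τ) :
    ∃ f : ℝ → ℝ, PolyBdd f ∧ ∀ {n p : ℕ} {X : Fin n → EuclideanSpace ℝ (Fin p)} {ε : Fin n → ℝ}
      {T : ℝ}, DataBound ρ τ X ε T → ∀ i,
      ‖betaHat ρ τ X ε - betaTilde ρ τ X ε i‖ ≤ f T / n ∧
      (∀ j, j ≠ i → |residLoo ρ τ X ε i j - resid ρ τ X ε j| ≤ f T / √n) ∧
      |resid ρ τ X ε i - proxResid ρ τ X ε i| ≤ f T / √n := by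
  have hD := hρ.nonneg
  have hl := hρ.isLoss
  obtain ⟨g, hg⟩ : ∃ f : ℝ → ℝ, f = fun y => (|deriv (deriv ρ) 0| + D) * (1 + y) ^ (M + 2) := ⟨_, rfl⟩
  have hgP : ∀ {f}, PolyBdd f → PolyBdd fun T => g (f T) := fun hf => hg ▸
    (PolyBdd.const (by positivity)).mul (((PolyBdd.const zero_le_one).add hf).pow _)
  have hψ : ∀ {x y : ℝ}, |x| ≤ y → |deriv ρ x| ≤ g y := fun h =>
    (hρ.abs_deriv_le _).trans (by simp only [hg]; gcongr)
  have hg0 : ∀ y, 0 ≤ y → 0 ≤ g y := fun y hy => by simp only [hg]; positivity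
  -- The bounds, in order of dependence: `bβ` for ‖β̂_(i)‖, `br` for |r̃_{i,(i)}|, `bψ` for ψ at R_i
  -- and at the prox, `bR` for every |r̃_{j,(i)}|, `bh` for √n |X_jᵀη| with j ≠ i, `be` for n times
  -- the Taylor remainder, `bΔ` for n‖β̂ - β̃_i‖.
  obtain ⟨bβ, hbβ⟩ : ∃ f : ℝ → ℝ, f = fun T => g T * T / τ := ⟨_, rfl⟩
  obtain ⟨br, hbr⟩ : ∃ f : ℝ → ℝ, f = fun T => T + T * bβ T := ⟨_, rfl⟩
  obtain ⟨bψ, hbψ⟩ : ∃ f : ℝ → ℝ, f = fun T => g (br T) := ⟨_, rfl⟩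
  obtain ⟨bR, hbR⟩ : ∃ f : ℝ → ℝ, f = fun T => br T + bψ T * T * T / τ := ⟨_, rfl⟩
  obtain ⟨bh, hbh⟩ : ∃ f : ℝ → ℝ, f = fun T => bψ T * T * T / τ := ⟨_, rfl⟩
  obtain ⟨be, hbe⟩ : ∃ f : ℝ → ℝ, f = fun T => D * (1 + 2 * bR T + bh T) ^ M * bh T ^ 2 := ⟨_, rfl⟩
  obtain ⟨bΔ, hbΔ⟩ : ∃ f : ℝ → ℝ, f = fun T => be T * T / τ := ⟨_, rfl⟩
  have Pβ : PolyBdd bβ := hbβ ▸ ((hgP .id).mul .id).div_const hτ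
  have Pr : PolyBdd br := hbr ▸ PolyBdd.id.add (PolyBdd.id.mul Pβ)
  have Pψ : PolyBdd bψ := hbψ ▸ hgP Pr
  have Ph : PolyBdd bh := hbh ▸ ((Pψ.mul .id).mul .id).div_const hτ
  have PR : PolyBdd bR := hbR ▸ Pr.add (((Pψ.mul .id).mul .id).div_const hτ)
  have Pe : PolyBdd be := hbe ▸ ((PolyBdd.const hD).mul ((((PolyBdd.const zero_le_one).add
    ((PolyBdd.const zero_le_two).mul PR)).add Ph).pow M)).mul (Ph.pow 2)
  have PΔ : PolyBdd bΔ := hbΔ ▸ (Pe.mul .id).div_const hτ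
  refine ⟨fun T => bΔ T + T * bΔ T + bh T, (PΔ.add (PolyBdd.id.mul PΔ)).add Ph,
    fun {n p X ε T} h => ?_⟩
  have hT := h.one_le
  have hT0 : 0 ≤ T := by linarith
  have nn : ∀ {f}, PolyBdd f → 0 ≤ f T := fun hf => by
    obtain ⟨C, K, _, hC⟩ := hf
    exact (hC T hT).1
  rcases Nat.eq_zero_or_pos n with h0 | h0
  · subst h0; exact fun i => i.elim0
  have hn : (0:ℝ) < n := by exact_mod_cast h0
  have hsn : 0 < √(n:ℝ) := Real.sqrt_pos.2 hn
  have hss : √(n:ℝ) * √n = n := Real.mul_self_sqrt hn.le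
  have hs1 : 1 ≤ √(n:ℝ) := by
    rw [Real.one_le_sqrt]; exact_mod_cast h0
  have hβ : ∀ i, ‖betaLoo ρ τ X ε i‖ ≤ bβ T := fun i => by
    have h1 := norm_sub_argMin_le X ε (Finset.univ.erase i) hl hτ 0
    rw [zero_sub, norm_neg] at h1
    refine h1.trans ?_
    simp only [hbβ]
    gcongr
    rw [grad, smul_zero, zero_sub, norm_neg]
    refine h.norm_avg_le _ _ (hg0 T hT0) fun j _ => ?_
    rw [inner_zero_right, sub_zero]
    exact hψ (h.eps j)
  have hr : ∀ i, |residLoo ρ τ X ε i i| ≤ br T := fun i => by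
    rw [residLoo, hbr]
    refine (abs_sub _ _).trans (add_le_add (h.eps i) ((h.loo i).trans ?_))
    exact mul_le_mul_of_nonneg_left (hβ i) hT0
  have hψR : ∀ i, |deriv ρ (resid ρ τ X ε i)| ≤ bψ T := fun i => by
    rw [hbψ]
    exact hψ ((abs_resid_le hl hτ i).1.trans (hr i))
  have hψP : ∀ i, |deriv ρ (proxResid ρ τ X ε i)| ≤ bψ T := fun i => by
    rw [hbψ]
    exact hψ ((abs_prox_le hl (cLoo_nonneg X ε i hl hτ) _).trans (hr i))
  have hdiff : ∀ i j, residLoo ρ τ X ε i j - resid ρ τ X ε j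
      = inner ℝ (X j) (betaHat ρ τ X ε - betaLoo ρ τ X ε i) := fun i j => by
    rw [inner_sub_right, residLoo, resid]; ring
  -- A bound of order one suffices here: R_j is controlled by r̃_{j,(j)}, and ‖X_j‖ ‖β̂ - β̂_(i)‖
  -- has the two factors √n cancelled by 1/n.
  have hR : ∀ i j, |residLoo ρ τ X ε i j| ≤ bR T := fun i j => by
    have h1 : |residLoo ρ τ X ε i j - resid ρ τ X ε j| ≤ bψ T * T * T / τ := by
      rw [hdiff]
      calc _ ≤ ‖X j‖ * ‖betaHat ρ τ X ε - betaLoo ρ τ X ε i‖ := abs_real_inner_le_norm _ _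
        _ ≤ (√n * T) * (1 / n * bψ T * (√n * T) / τ) := by
          refine mul_le_mul (h.norm_le j) ((abs_resid_le hl hτ i).2.trans ?_)
            (norm_nonneg _) (by positivity)
          have := hψR i
          have := h.norm_le i
          have := nn Pψ
          gcongr
        _ = (√n * √n) / n * (bψ T * T * T / τ) := by ring
        _ = _ := by rw [hss, div_self hn.ne', one_mul]
    have h2 := (abs_resid_le hl hτ j).1.trans (hr j)
    have h3 := abs_add_le (residLoo ρ τ X ε i j - resid ρ τ X ε j) (resid ρ τ X ε j)
    rw [sub_add_cancel] at h3
    simp only [hbR]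
    linarith
  intro i
  -- Symmetry of the resolvent moves it from X_i to X_j, producing the product of X_i with a
  -- leave-one-out vector that `DataBound.res` controls without the factor ‖X_i‖.
  have hη : ∀ j, j ≠ i →
      |inner ℝ (X j) (betaTilde ρ τ X ε i - betaLoo ρ τ X ε i)| ≤ bh T / √n := fun j hj => by
    have e1 : betaTilde ρ τ X ε i - betaLoo ρ τ X ε i
        = ((1 / (n : ℝ)) * deriv ρ (proxResid ρ τ X ε i)) • resolvent ρ τ X ε i (X i) := by
      rw [betaTilde, add_sub_cancel_left]; rfl
    rw [e1, inner_smul_right, inner_resolvent_comm X ε i hl hτ, abs_mul, abs_mul,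
      abs_of_nonneg (by positivity : 0 ≤ 1 / (n:ℝ))]
    calc _ ≤ 1 / (n:ℝ) * bψ T * (T * (√n * T / τ)) := by
          have := nn Pψ
          refine mul_le_mul (mul_le_mul_of_nonneg_left (hψP i) (by positivity))
            ((h.res i j hj).trans (mul_le_mul_of_nonneg_left
              ((norm_resolvent_le X ε i hl hτ _).trans ?_) hT0)) (abs_nonneg _) (by positivity)
          have := h.norm_le j
          gcongr
      _ = (√n / n) * bh T := by simp only [hbh]; ring
      _ = bh T / √n := by
          have : √(n:ℝ) / n = 1 / √n := by
            rw [div_eq_div_iff hn.ne' hsn.ne', hss, one_mul]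
          rw [this]; ring
  have hΔ : ‖betaHat ρ τ X ε - betaTilde ρ τ X ε i‖ ≤ bΔ T / n := by
    rw [norm_sub_rev]
    refine (norm_sub_argMin_le X ε Finset.univ hl hτ _).trans ?_
    rw [grad_betaTilde hl hτ]
    have : bΔ T / n = (be T / n) * T / τ := by simp only [hbΔ]; ring
    rw [this]
    gcongr
    have hbe0 := nn Pe
    refine h.norm_avg_le _ _ (by positivity) fun j hj => ?_
    rw [abs_neg]
    refine (hρ.abs_taylor_le _ _).trans ?_
    have hηj := hη j (Finset.ne_of_mem_erase hj)
    set t := inner ℝ (X j) (betaTilde ρ τ X ε i - betaLoo ρ τ X ε i)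
    have hb0 := nn Ph
    have hηj' : |t| ≤ bh T := hηj.trans (div_le_self hb0 hs1)
    have hsq : t ^ 2 ≤ bh T ^ 2 / n := by
      rw [← sq_abs, ← Real.sq_sqrt hn.le, ← div_pow]
      gcongr
    calc _ ≤ D * (1 + 2 * bR T + bh T) ^ M * (bh T ^ 2 / n) := by
          have := hR i j
          have := nn PR
          gcongr
      _ = be T / n := by simp only [hbe]; ring
  have hΔ0 := nn PΔ
  have hh0 := nn Ph
  have hXΔ : ∀ j v, ‖v‖ ≤ bΔ T / n → |inner ℝ (X j) v| ≤ T * bΔ T / √n := fun j v hv => by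
    calc _ ≤ ‖X j‖ * ‖v‖ := abs_real_inner_le_norm _ _
      _ ≤ (√n * T) * (bΔ T / n) := mul_le_mul (h.norm_le j) hv (norm_nonneg _) (by positivity)
      _ = (√n / n) * (T * bΔ T) := by ring
      _ = T * bΔ T / √n := by
          have : √(n:ℝ) / n = 1 / √n := by
            rw [div_eq_div_iff hn.ne' hsn.ne', hss, one_mul]
          rw [this]; ring
  have hTΔ : 0 ≤ T * bΔ T := by positivity
  refine ⟨hΔ.trans (by gcongr; linarith), fun j hj => ?_, ?_⟩
  · have e1 : betaHat ρ τ X ε - betaLoo ρ τ X ε i = (betaHat ρ τ X ε - betaTilde ρ τ X ε i)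
        + (betaTilde ρ τ X ε i - betaLoo ρ τ X ε i) := by abel
    rw [hdiff, e1, inner_add_right]
    refine (abs_add_le _ _).trans ((add_le_add (hXΔ j _ hΔ) (hη j hj)).trans ?_)
    rw [← add_div]
    gcongr
    linarith
  -- The prox value is the i-th residual of β̃_i, so the difference is linear in the error already
  -- bounded.
  · have e1 : resid ρ τ X ε i - proxResid ρ τ X ε i
        = inner ℝ (X i) (betaTilde ρ τ X ε i - betaHat ρ τ X ε) := by
      have h1 := prox_add hl (cLoo_nonneg X ε i hl hτ) (residLoo ρ τ X ε i i)
      rw [inner_sub_right, betaTilde, inner_add_right, inner_smul_right, resid]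
      simp only [proxResid, cLoo, residLoo] at h1 ⊢
      linear_combination -h1
    rw [e1]
    refine (hXΔ i _ (by rwa [norm_sub_rev])).trans ?_
    gcongr
    linarith

end Deterministic

/-! ### Continuous dependence on the data -/

section Continuity

variable {n p : ℕ} {ρ : ℝ → ℝ} {τ D : ℝ} {M : ℕ}

/-- In the applications `B z₀ z` measures how badly the solution for z₀ fails the equation for z; it
is continuous in z and vanishes at z₀. Continuity is wanted only to obtain measurability of the
estimators. -/
theorem continuous_of_norm_sub_le {Z E : Type*} [TopologicalSpace Z] [SeminormedAddCommGroup E]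
    {f : Z → E} {B : Z → Z → ℝ} (hB : ∀ z₀, ContinuousAt (B z₀) z₀) (h0 : ∀ z, B z z = 0)
    (h : ∀ z₀ z, ‖f z₀ - f z‖ ≤ B z₀ z) : Continuous f := by
  rw [continuous_iff_continuousAt]
  intro z₀
  rw [ContinuousAt, tendsto_iff_norm_sub_tendsto_zero]
  have := hB z₀
  rw [ContinuousAt, h0] at this
  exact squeeze_zero (fun _ => norm_nonneg _) (fun z => norm_sub_rev (f z) _ ▸ h z₀ z) this

theorem continuous_argMin_objective (hρ : IsLoss ρ) (hτ : 0 < τ) (s : Finset (Fin n)) :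
    Continuous fun d : (Fin n → EuclideanSpace ℝ (Fin p)) × (Fin n → ℝ) =>
      argMin (objective ρ τ d.1 d.2 s) := by
  refine continuous_of_norm_sub_le
    (B := fun d₀ d => ‖grad ρ τ d.1 d.2 s (argMin (objective ρ τ d₀.1 d₀.2 s))‖ / τ)
    (fun d₀ => ?_) (fun d => by simp [grad_argMin d.1 d.2 s hρ hτ])
    fun d₀ d => norm_sub_argMin_le _ _ _ hρ hτ _
  have := hρ.continuous_deriv
  refine Continuous.continuousAt ?_
  unfold grad
  fun_prop

theorem continuous_betaLoo (hρ : IsLoss ρ) (hτ : 0 < τ) (i : Fin n) :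
    Continuous fun d : (Fin n → EuclideanSpace ℝ (Fin p)) × (Fin n → ℝ) =>
      betaLoo ρ τ d.1 d.2 i := continuous_argMin_objective hρ hτ _

theorem continuous_betaHat (hρ : IsLoss ρ) (hτ : 0 < τ) :
    Continuous fun d : (Fin n → EuclideanSpace ℝ (Fin p)) × (Fin n → ℝ) =>
      betaHat ρ τ d.1 d.2 := continuous_argMin_objective hρ hτ _

theorem continuous_resid (hρ : IsLoss ρ) (hτ : 0 < τ) (i : Fin n) :
    Continuous fun d : (Fin n → EuclideanSpace ℝ (Fin p)) × (Fin n → ℝ) =>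
      resid ρ τ d.1 d.2 i := by
  have := continuous_betaHat (n := n) (p := p) hρ hτ
  unfold resid
  fun_prop

theorem continuous_residLoo (hρ : IsLoss ρ) (hτ : 0 < τ) (i j : Fin n) :
    Continuous fun d : (Fin n → EuclideanSpace ℝ (Fin p)) × (Fin n → ℝ) =>
      residLoo ρ τ d.1 d.2 i j := by
  have := continuous_betaLoo (p := p) hρ hτ i
  unfold residLoo
  fun_prop

theorem shiftedS_sub (X : Fin n → EuclideanSpace ℝ (Fin p)) (ε : Fin n → ℝ) (i : Fin n)
    (v w : EuclideanSpace ℝ (Fin p)) :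
    shiftedS ρ τ X ε i (v - w) = shiftedS ρ τ X ε i v - shiftedS ρ τ X ε i w := by
  simp only [shiftedS, inner_sub_right, mul_sub, sub_smul, Finset.sum_sub_distrib, smul_sub]
  abel

theorem resolvent_shiftedS (hρ : IsLoss ρ) (hτ : 0 < τ)
    (X : Fin n → EuclideanSpace ℝ (Fin p)) (ε : Fin n → ℝ) (i : Fin n)
    (w : EuclideanSpace ℝ (Fin p)) :
    resolvent ρ τ X ε i (shiftedS ρ τ X ε i w) = w := by
  rw [← matS_mulVec, resolvent]
  simp only [Matrix.mulVec_mulVec]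
  rw [Matrix.nonsing_inv_mul _ (isUnit_det_matS X ε i hρ hτ)]
  simp

theorem continuous_resolvent (hρ : IsPolyLoss ρ D M) (hτ : 0 < τ) (i : Fin n)
    {x : (Fin n → EuclideanSpace ℝ (Fin p)) × (Fin n → ℝ) → EuclideanSpace ℝ (Fin p)}
    (hx : Continuous x) :
    Continuous fun d => resolvent ρ τ d.1 d.2 i (x d) := by
  refine continuous_of_norm_sub_le
    (B := fun d₀ d => ‖shiftedS ρ τ d.1 d.2 i (resolvent ρ τ d₀.1 d₀.2 i (x d₀)) - x d‖ / τ)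
    (fun d₀ => ?_) (fun d => by simp [shiftedS_resolvent d.1 d.2 i hρ.isLoss hτ])
    fun d₀ d => ?_
  · have := hρ.continuous_deriv2
    have := continuous_residLoo (n := n) (p := p) hρ.isLoss hτ i
    refine Continuous.continuousAt ?_
    unfold shiftedS
    fun_prop
  · have h := norm_resolvent_le d.1 d.2 i hρ.isLoss hτ
      (shiftedS ρ τ d.1 d.2 i (resolvent ρ τ d₀.1 d₀.2 i (x d₀) - resolvent ρ τ d.1 d.2 i (x d)))
    rw [resolvent_shiftedS hρ.isLoss hτ, shiftedS_sub, shiftedS_resolvent _ _ _ hρ.isLoss hτ] at h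
    exact h

theorem continuous_resolventX (hρ : IsPolyLoss ρ D M) (hτ : 0 < τ) (i : Fin n) :
    Continuous fun d : (Fin n → EuclideanSpace ℝ (Fin p)) × (Fin n → ℝ) =>
      resolventX ρ τ d.1 d.2 i :=
  continuous_resolvent hρ hτ i (x := fun d => d.1 i) (by fun_prop)

theorem continuous_cLoo (hρ : IsPolyLoss ρ D M) (hτ : 0 < τ) (i : Fin n) :
    Continuous fun d : (Fin n → EuclideanSpace ℝ (Fin p)) × (Fin n → ℝ) =>
      cLoo ρ τ d.1 d.2 i := by
  have := continuous_resolventX (p := p) hρ hτ i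
  unfold cLoo
  fun_prop

theorem continuous_proxResid (hρ : IsPolyLoss ρ D M) (hτ : 0 < τ) (i : Fin n) :
    Continuous fun d : (Fin n → EuclideanSpace ℝ (Fin p)) × (Fin n → ℝ) =>
      proxResid ρ τ d.1 d.2 i := by
  refine continuous_of_norm_sub_le
    (B := fun d₀ d => |proxResid ρ τ d₀.1 d₀.2 i
      + cLoo ρ τ d.1 d.2 i * deriv ρ (proxResid ρ τ d₀.1 d₀.2 i) - residLoo ρ τ d.1 d.2 i i|)
    (fun d₀ => ?_) (fun d => ?_)
    fun d₀ d => abs_sub_prox_le hρ.isLoss (cLoo_nonneg d.1 d.2 i hρ.isLoss hτ) _ _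
  · have := continuous_cLoo (p := p) hρ hτ i
    have := continuous_residLoo (p := p) hρ.isLoss hτ i i
    exact Continuous.continuousAt (by fun_prop)
  · have := prox_add hρ.isLoss (cLoo_nonneg d.1 d.2 i hρ.isLoss hτ) (residLoo ρ τ d.1 d.2 i i)
    simp only [proxResid]
    rw [this, sub_self, abs_zero]

theorem continuous_betaTilde (hρ : IsPolyLoss ρ D M) (hτ : 0 < τ) (i : Fin n) :
    Continuous fun d : (Fin n → EuclideanSpace ℝ (Fin p)) × (Fin n → ℝ) =>
      betaTilde ρ τ d.1 d.2 i := by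
  have := continuous_resolventX (p := p) hρ hτ i
  have := continuous_betaLoo (p := p) hρ.isLoss hτ i
  have := continuous_proxResid (p := p) hρ hτ i
  have := hρ.isLoss.continuous_deriv
  unfold betaTilde
  fun_prop

end Continuity

/-! ### The observation that is left out does not matter -/

section Update

variable {n p : ℕ} (ρ : ℝ → ℝ) (τ : ℝ) (X : Fin n → EuclideanSpace ℝ (Fin p)) (ε : Fin n → ℝ)
  (i : Fin n) (x : EuclideanSpace ℝ (Fin p))

theorem betaLoo_update : betaLoo ρ τ (Function.update X i x) ε i = betaLoo ρ τ X ε i := by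
  unfold betaLoo
  congr 1
  funext β
  unfold objective
  congr 2
  refine Finset.sum_congr rfl fun j hj => ?_
  rw [Function.update_of_ne (Finset.ne_of_mem_erase hj)]

theorem resolvent_update (y : EuclideanSpace ℝ (Fin p)) :
    resolvent ρ τ (Function.update X i x) ε i y = resolvent ρ τ X ε i y := by
  have : matS ρ τ (Function.update X i x) ε i = matS ρ τ X ε i := by
    unfold matS
    congr 1
    refine Finset.sum_congr rfl fun j hj => ?_
    rw [residLoo, residLoo, betaLoo_update, Function.update_of_ne (Finset.ne_of_mem_erase hj)]
  rw [resolvent, this, resolvent]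

end Update

/-! ### Exponential moments -/

section ExpMoment

variable {Ω : Type*} [MeasurableSpace Ω] {μ : Measure Ω} [IsProbabilityMeasure μ]

/-- Layer-cake formula for Z² at half the tail rate: the weight (c/2)exp(ct/2) against the tail C
exp(-ct) integrates to C. -/
theorem lintegral_exp_sq_le_of_tail {Z : Ω → ℝ} (hZ : Measurable Z) {C c : ℝ} (hC : 0 ≤ C)
    (hc : 0 < c) (h : ∀ t > 0, μ.real {ω | t < |Z ω|} ≤ C * Real.exp (-c * t ^ 2)) :
    ∫⁻ ω, ENNReal.ofReal (Real.exp (c / 2 * Z ω ^ 2)) ∂μ ≤ ENNReal.ofReal (1 + C) := by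
  have hint : ∀ s : ℝ, ∫ t in (0:ℝ)..s, c / 2 * Real.exp (c / 2 * t)
      = Real.exp (c / 2 * s) - 1 := fun s => by
    rw [intervalIntegral.integral_eq_sub_of_hasDerivAt (f := fun t => Real.exp (c / 2 * t))]
    · simp
    · intro t _
      simpa [mul_comm] using ((hasDerivAt_id t).const_mul (c / 2)).exp
    · exact Continuous.intervalIntegrable (by fun_prop) _ _
  have hlc := lintegral_comp_eq_lintegral_meas_lt_mul μ (f := fun ω => Z ω ^ 2)
    (g := fun t => c / 2 * Real.exp (c / 2 * t)) (ae_of_all _ fun ω => sq_nonneg _)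
    (by fun_prop) (fun t _ => Continuous.intervalIntegrable (by fun_prop) _ _)
    (ae_of_all _ fun t => by positivity)
  simp only [hint] at hlc
  have h1 : ∀ ω, ENNReal.ofReal (Real.exp (c / 2 * Z ω ^ 2))
      = 1 + ENNReal.ofReal (Real.exp (c / 2 * Z ω ^ 2) - 1) := fun ω => by
    have : 0 ≤ Real.exp (c / 2 * Z ω ^ 2) - 1 := by
      have := Real.one_le_exp (x := c / 2 * Z ω ^ 2) (by positivity)
      linarith
    rw [← ENNReal.ofReal_one, ← ENNReal.ofReal_add zero_le_one this]
    congr 1; ring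
  simp only [h1]
  rw [lintegral_add_left measurable_const, hlc, lintegral_const, measure_univ, mul_one,
    ENNReal.ofReal_add zero_le_one hC, ENNReal.ofReal_one]
  gcongr
  have hcc : -(c / 2) < 0 := by linarith
  calc ∫⁻ t in Ioi 0, μ {a | t < Z a ^ 2} * ENNReal.ofReal (c / 2 * Real.exp (c / 2 * t))
      ≤ ∫⁻ t in Ioi 0, ENNReal.ofReal (C * (c / 2) * Real.exp (-(c / 2) * t)) := by
        refine setLIntegral_mono (by fun_prop) fun t ht => ?_
        have ht0 : 0 < t := ht
        have hs : {a | t < Z a ^ 2} = {a | √t < |Z a|} := by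
          ext a
          rw [Set.mem_ofPred_eq, Set.mem_ofPred_eq, ← Real.sqrt_sq_eq_abs,
            Real.sqrt_lt_sqrt_iff ht0.le]
        have h2 := h (√t) (Real.sqrt_pos.2 ht0)
        rw [← hs, Real.sq_sqrt ht0.le] at h2
        rw [← ofReal_measureReal, ← ENNReal.ofReal_mul measureReal_nonneg]
        refine ENNReal.ofReal_le_ofReal ?_
        calc _ ≤ (C * Real.exp (-c * t)) * (c / 2 * Real.exp (c / 2 * t)) := by gcongr
          _ = C * (c / 2) * (Real.exp (-c * t) * Real.exp (c / 2 * t)) := by ring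
          _ = _ := by rw [← Real.exp_add]; congr 2; ring
    _ = ENNReal.ofReal (∫ t in Ioi 0, C * (c / 2) * Real.exp (-(c / 2) * t)) := by
        rw [ofReal_integral_eq_lintegral_ofReal]
        · exact (integrableOn_exp_mul_Ioi hcc 0).const_mul _
        · exact ae_of_all _ fun t => by positivity
    _ = ENNReal.ofReal C := by
        rw [integral_const_mul, integral_exp_mul_Ioi hcc]
        congr 1
        simp
        field_simp

/-- Splitting at log A is what makes an exponential moment A yield moments of size log A, with k
entering only through constants. -/
theorem pow_le_of_log {y A : ℝ} (hy : 0 ≤ y) (hA : 1 ≤ A) (k : ℕ) :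
    y ^ k ≤ 2 ^ k * (Real.log A ^ k + k.factorial / A * Real.exp y) := by
  have hl : 0 ≤ Real.log A := Real.log_nonneg hA
  have hA0 : 0 < A := by linarith
  rcases le_total y (Real.log A) with h | h
  · have h1 : y ^ k ≤ Real.log A ^ k := by gcongr
    have h2 : (1:ℝ) ≤ 2 ^ k := one_le_pow₀ one_le_two
    have h3 : 0 ≤ k.factorial / A * Real.exp y := by positivity
    nlinarith [pow_nonneg hl k]
  · set z := y - Real.log A with hz
    have hz0 : 0 ≤ z := by linarith
    have h1 : z ^ k ≤ k.factorial / A * Real.exp y := by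
      have h2 := Real.pow_div_factorial_le_exp z hz0 k
      rw [div_le_iff₀ (by positivity)] at h2
      refine h2.trans_eq ?_
      rw [hz, Real.exp_sub, Real.exp_log hA0]
      field_simp
    have h3 : y ^ k ≤ 2 ^ (k - 1) * (Real.log A ^ k + z ^ k) := by
      have := add_pow_le hl hz0 k
      rwa [hz, add_sub_cancel] at this
    refine h3.trans ?_
    have : (2:ℝ) ^ (k - 1) ≤ 2 ^ k := pow_le_pow_right₀ one_le_two (by omega)
    gcongr

theorem lintegral_pow_le_of_exp {Y : Ω → ℝ} (hY : Measurable Y) (h0 : ∀ ω, 0 ≤ Y ω) {A : ℝ}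
    (hA : 1 ≤ A) (h : ∫⁻ ω, ENNReal.ofReal (Real.exp (Y ω)) ∂μ ≤ ENNReal.ofReal A) (k : ℕ) :
    ∫⁻ ω, ENNReal.ofReal (Y ω ^ k) ∂μ
      ≤ ENNReal.ofReal (2 ^ k * (Real.log A ^ k + k.factorial)) := by
  have hl : 0 ≤ Real.log A := Real.log_nonneg hA
  have hA0 : 0 < A := by linarith
  calc ∫⁻ ω, ENNReal.ofReal (Y ω ^ k) ∂μ
      ≤ ∫⁻ ω, (ENNReal.ofReal (2 ^ k * Real.log A ^ k)
        + ENNReal.ofReal (2 ^ k * (k.factorial / A)) * ENNReal.ofReal (Real.exp (Y ω))) ∂μ := by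
        refine lintegral_mono fun ω => ?_
        rw [← ENNReal.ofReal_mul (by positivity), ← ENNReal.ofReal_add (by positivity)
          (by positivity)]
        refine ENNReal.ofReal_le_ofReal ((pow_le_of_log (h0 ω) hA k).trans_eq (by ring))
    _ = ENNReal.ofReal (2 ^ k * Real.log A ^ k) + ENNReal.ofReal (2 ^ k * (k.factorial / A))
        * ∫⁻ ω, ENNReal.ofReal (Real.exp (Y ω)) ∂μ := by
        rw [lintegral_add_left measurable_const, lintegral_const, measure_univ, mul_one,
          lintegral_const_mul _ (by fun_prop)]
    _ ≤ ENNReal.ofReal (2 ^ k * Real.log A ^ k) + ENNReal.ofReal (2 ^ k * (k.factorial / A))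
        * ENNReal.ofReal A := by gcongr
    _ = _ := by
        rw [← ENNReal.ofReal_mul (by positivity), ← ENNReal.ofReal_add (by positivity)
          (by positivity)]
        congr 1
        field_simp

theorem eLpNorm_le_of_exp {Y : Ω → ℝ} (hY : Measurable Y) (h0 : ∀ ω, 0 ≤ Y ω) {A : ℝ}
    (hA : 1 ≤ A) (h : ∫⁻ ω, ENNReal.ofReal (Real.exp (Y ω)) ∂μ ≤ ENNReal.ofReal A) {k : ℕ}
    (hk : 1 ≤ k) :
    eLpNorm Y k μ ≤ ENNReal.ofReal (2 * (Real.log A + k.factorial)) := by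
  have hl : 0 ≤ Real.log A := Real.log_nonneg hA
  have hk0 : (0:ℝ) < k := by exact_mod_cast hk
  rw [eLpNorm_eq_lintegral_rpow_enorm_toReal (by simp; omega) (by simp)]
  simp only [ENNReal.toReal_natCast, ENNReal.rpow_natCast]
  have h1 : ∀ ω, ‖Y ω‖ₑ ^ k = ENNReal.ofReal (Y ω ^ k) := fun ω => by
    rw [Real.enorm_eq_ofReal (h0 ω), ENNReal.ofReal_pow (h0 ω)]
  simp only [h1]
  calc _ ≤ (ENNReal.ofReal (2 * (Real.log A + k.factorial)) ^ k) ^ (1 / (k : ℝ)) := by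
        gcongr
        refine (lintegral_pow_le_of_exp hY h0 hA h k).trans ?_
        rw [← ENNReal.ofReal_pow (by positivity), mul_pow]
        refine ENNReal.ofReal_le_ofReal (mul_le_mul_of_nonneg_left ?_ (by positivity))
        have h2 : (1:ℝ) ≤ k.factorial := by exact_mod_cast k.factorial_pos
        exact (add_le_add le_rfl (le_self_pow₀ h2 (by omega))).trans
          (pow_add_pow_le hl (by positivity) (by omega))
    _ = _ := by
        rw [← ENNReal.rpow_natCast, ← ENNReal.rpow_mul, mul_one_div_cancel hk0.ne',
          ENNReal.rpow_one]

/-- A centred direction of a vector with sub-Gaussian concentration around some value has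
explicit exponential moments of its square. -/
theorem lintegral_exp_sq_le {Y : Ω → ℝ} (hY : Measurable Y) {C c m : ℝ} (hC : 0 ≤ C)
    (hc : 0 < c) (hc1 : c ≤ 1)
    (h : ∀ t > 0, μ.real {ω | t < |Y ω - m|} ≤ C * Real.exp (-c * t ^ 2))
    (h2 : ∫⁻ ω, ENNReal.ofReal (Y ω ^ 2) ∂μ ≤ 1) :
    ∫⁻ ω, ENNReal.ofReal (Real.exp (c / 4 * Y ω ^ 2)) ∂μ
      ≤ ENNReal.ofReal (Real.exp 5 * (1 + C) ^ 5) := by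
  have hE := lintegral_exp_sq_le_of_tail (hY.sub_const m) hC hc h
  have hl : 0 ≤ Real.log (1 + C) := Real.log_nonneg (by linarith)
  have hM := lintegral_pow_le_of_exp (Y := fun ω => c / 2 * (Y ω - m) ^ 2) (by fun_prop)
    (fun ω => by positivity) (by linarith : 1 ≤ 1 + C) hE 1
  simp only [pow_one, Nat.factorial_one, Nat.cast_one] at hM
  -- The centre m is arbitrary, so it is bounded through m² ≤ 2(Y - m)² + 2Y², using the tail for
  -- the first term, E Y² ≤ 1 for the second, and c ≤ 1. Afterwards Y² ≤ 2(Y - m)² + 2m² explains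
  -- the rate c/4.
  have hm : c / 2 * m ^ 2 ≤ 4 * Real.log (1 + C) + 5 := by
    have h3 : ENNReal.ofReal (c / 2 * m ^ 2)
        ≤ ENNReal.ofReal (2 * (2 * (Real.log (1 + C) + 1)) + c) := by
      calc ENNReal.ofReal (c / 2 * m ^ 2) = ∫⁻ _, ENNReal.ofReal (c / 2 * m ^ 2) ∂μ := by
            rw [lintegral_const, measure_univ, mul_one]
        _ ≤ ∫⁻ ω, (ENNReal.ofReal 2 * ENNReal.ofReal (c / 2 * (Y ω - m) ^ 2)
            + ENNReal.ofReal c * ENNReal.ofReal (Y ω ^ 2)) ∂μ := by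
            refine lintegral_mono fun ω => ?_
            rw [← ENNReal.ofReal_mul (by positivity), ← ENNReal.ofReal_mul (by positivity),
              ← ENNReal.ofReal_add (by positivity) (by positivity)]
            refine ENNReal.ofReal_le_ofReal ?_
            nlinarith [mul_nonneg hc.le (sq_nonneg (2 * Y ω - m))]
        _ ≤ ENNReal.ofReal 2 * ENNReal.ofReal (2 * (Real.log (1 + C) + 1))
            + ENNReal.ofReal c * 1 := by
            rw [lintegral_add_left (by fun_prop), lintegral_const_mul _ (by fun_prop),
              lintegral_const_mul _ (by fun_prop)]
            gcongr
        _ = _ := by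
            rw [mul_one, ← ENNReal.ofReal_mul (by positivity), ← ENNReal.ofReal_add
              (by positivity) hc.le]
    rw [ENNReal.ofReal_le_ofReal_iff (by positivity)] at h3
    linarith
  calc ∫⁻ ω, ENNReal.ofReal (Real.exp (c / 4 * Y ω ^ 2)) ∂μ
      ≤ ∫⁻ ω, ENNReal.ofReal (Real.exp 5 * (1 + C) ^ 4)
        * ENNReal.ofReal (Real.exp (c / 2 * (Y ω - m) ^ 2)) ∂μ := by
        refine lintegral_mono fun ω => ?_
        rw [← ENNReal.ofReal_mul (by positivity)]
        refine ENNReal.ofReal_le_ofReal ?_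
        have e1 : Real.exp 5 * (1 + C) ^ 4 = Real.exp (4 * Real.log (1 + C) + 5) := by
          rw [add_comm, Real.exp_add, mul_comm 4, ← Real.rpow_def_of_pos (by linarith)]
          norm_cast
          rw [add_comm C, mul_comm]
        rw [e1, ← Real.exp_add]
        refine Real.exp_le_exp.2 ?_
        nlinarith [mul_nonneg hc.le (sq_nonneg (Y ω - 2 * m))]
    _ = ENNReal.ofReal (Real.exp 5 * (1 + C) ^ 4)
        * ∫⁻ ω, ENNReal.ofReal (Real.exp (c / 2 * (Y ω - m) ^ 2)) ∂μ :=
        lintegral_const_mul _ (by fun_prop)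
    _ ≤ ENNReal.ofReal (Real.exp 5 * (1 + C) ^ 4) * ENNReal.ofReal (1 + C) := by gcongr
    _ = _ := by
        rw [← ENNReal.ofReal_mul (by positivity)]
        congr 1; ring

theorem lintegral_inner_sq {p : ℕ} {Y : Ω → EuclideanSpace ℝ (Fin p)} (hY : MemLp Y 2 μ)
    (hmean : ∀ a, ∫ ω, Y ω a ∂μ = 0)
    (hcov : ∀ a b, covariance (fun ω => Y ω a) (fun ω => Y ω b) μ = if a = b then 1 else 0)
    (u : EuclideanSpace ℝ (Fin p)) :
    ∫⁻ ω, ENNReal.ofReal (inner ℝ (Y ω) u ^ 2) ∂μ = ENNReal.ofReal (‖u‖ ^ 2) := by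
  have hL : ∀ a, MemLp (fun ω => Y ω a) 2 μ := fun a => hY.eval_piLp a
  have hint : ∀ a b, Integrable (fun ω => Y ω a * Y ω b) μ := fun a b =>
    (hL a).integrable_mul (hL b)
  have hab : ∀ a b, ∫ ω, Y ω a * Y ω b ∂μ = if a = b then 1 else 0 := fun a b => by
    have := covariance_eq_sub (hL a) (hL b)
    rw [hcov, hmean, zero_mul, sub_zero] at this
    exact this.symm
  have e : ∀ ω, inner ℝ (Y ω) u ^ 2 = ∑ a, ∑ b, u a * u b * (Y ω a * Y ω b) := fun ω => by
    rw [sq, PiLp.inner_apply, Finset.sum_mul_sum]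
    refine Finset.sum_congr rfl fun a _ => Finset.sum_congr rfl fun b _ => ?_
    simp
    ring
  have hI : Integrable (fun ω => inner ℝ (Y ω) u ^ 2) μ := by
    simp only [e]
    exact integrable_finsetSum _ fun a _ => integrable_finsetSum _ fun b _ =>
      (hint a b).const_mul _
  rw [← ofReal_integral_eq_lintegral_ofReal hI (ae_of_all _ fun ω => sq_nonneg _)]
  congr 1
  simp only [e]
  rw [integral_finsetSum _ fun a _ => integrable_finsetSum _ fun b _ => (hint a b).const_mul _]
  simp only [integral_finsetSum _ fun b _ => (hint _ b).const_mul _, integral_const_mul, hab]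
  rw [EuclideanSpace.real_norm_sq_eq]
  simp [sq]

end ExpMoment

/-! ### Independence -/

section Independence

variable {Ω : Type*} [MeasurableSpace Ω] {μ : Measure Ω} [IsProbabilityMeasure μ]

/-- Fubini for the product law: a bound uniform over frozen v survives the substitution of an
independent random v. -/
theorem lintegral_le_of_indepFun {α β : Type*} [MeasurableSpace α] [MeasurableSpace β]
    {Y : Ω → α} {V : Ω → β} (hY : Measurable Y) (hV : Measurable V) (h : IndepFun Y V μ)
    {g : α → β → ENNReal} (hg : Measurable (Function.uncurry g)) {A : ENNReal}
    (hA : ∀ v, ∫⁻ ω, g (Y ω) v ∂μ ≤ A) : ∫⁻ ω, g (Y ω) (V ω) ∂μ ≤ A := by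
  have h1 : ∫⁻ ω, g (Y ω) (V ω) ∂μ = ∫⁻ z, Function.uncurry g z ∂(μ.map fun ω => (Y ω, V ω)) := by
    rw [lintegral_map hg (hY.prodMk hV)]; rfl
  have := Measure.isProbabilityMeasure_map (μ := μ) hV.aemeasurable
  have := Measure.isProbabilityMeasure_map (μ := μ) hY.aemeasurable
  rw [h1, h.map_prod_eq_prod_map_map hY.aemeasurable hV.aemeasurable, lintegral_prod_symm' _ hg]
  calc _ ≤ ∫⁻ _, A ∂(μ.map V) := by
        refine lintegral_mono fun v => ?_
        rw [lintegral_map (f := fun x => Function.uncurry g (x, v))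
          (hg.comp (measurable_id.prodMk measurable_const)) hY]
        exact hA v
    _ = A := by rw [lintegral_const, measure_univ, mul_one]

theorem indepFun_prodMk_right {α β γ : Type*} [MeasurableSpace α] [MeasurableSpace β]
    [MeasurableSpace γ] {A : Ω → α} {B : Ω → β} {C : Ω → γ} (hA : Measurable A)
    (hB : Measurable B) (hC : Measurable C) (h : IndepFun A B μ)
    (h' : IndepFun (fun ω => (A ω, B ω)) C μ) : IndepFun A (fun ω => (B ω, C ω)) μ := by
  have hBC : IndepFun B C μ := h'.comp measurable_snd measurable_id
  rw [indepFun_iff_map_prod_eq_prod_map_map hA.aemeasurable (hB.prodMk hC).aemeasurable,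
    hBC.map_prod_eq_prod_map_map hB.aemeasurable hC.aemeasurable]
  have := Measure.isProbabilityMeasure_map (μ := μ) hA.aemeasurable
  have := Measure.isProbabilityMeasure_map (μ := μ) hB.aemeasurable
  have := Measure.isProbabilityMeasure_map (μ := μ) hC.aemeasurable
  rw [← Measure.prodAssoc_prod, ← h.map_prod_eq_prod_map_map hA.aemeasurable hB.aemeasurable,
    ← h'.map_prod_eq_prod_map_map (hA.prodMk hB).aemeasurable hC.aemeasurable,
    Measure.map_map MeasurableEquiv.prodAssoc.measurable ((hA.prodMk hB).prodMk hC)]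
  rfl

/-- An observation is independent of all the other data. -/
theorem indepFun_update {n : ℕ} {E : Type*} [MeasurableSpace E] [Zero E]
    {X : Fin n → Ω → E} {ε : Fin n → Ω → ℝ} (hX : ∀ i, Measurable (X i))
    (hε : ∀ i, Measurable (ε i)) (h : iIndepFun X μ)
    (h' : IndepFun (fun ω i => X i ω) (fun ω i => ε i ω) μ) (i : Fin n) :
    IndepFun (X i) (fun ω => (Function.update (fun j => X j ω) i 0, fun j => ε j ω)) μ := by
  have hup : Measurable fun x : Fin n → E => Function.update x i 0 :=
    measurable_update_left
  have hXm : Measurable fun ω j => X j ω := measurable_pi_lambda _ hX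
  refine indepFun_prodMk_right (hX i) (hup.comp hXm) (measurable_pi_lambda _ hε) ?_ ?_
  · have h1 := h.indepFun_finset {i} (Finset.univ.erase i) (by simp) hX
    -- Padding by zero at i turns the family of the other observations into the updated full family.
    let φ : ((j : (Finset.univ.erase i : Finset (Fin n))) → E) → (Fin n → E) := fun y j =>
      if hj : j ∈ Finset.univ.erase i then y ⟨j, hj⟩ else 0
    have hφ : Measurable φ := by
      refine measurable_pi_lambda _ fun j => ?_
      by_cases hj : j ∈ Finset.univ.erase i
      · simp only [φ, hj, dif_pos]; exact measurable_pi_apply _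
      · simp only [φ, hj]; exact measurable_const
    have h2 := h1.comp (measurable_pi_apply (⟨i, by simp⟩ : ({i} : Finset (Fin n)))) hφ
    refine h2.congr (ae_of_all _ fun ω => rfl) (ae_of_all _ fun ω => ?_)
    funext j
    by_cases hj : j = i
    · subst hj; simp [φ]
    · simp [φ, hj]
  · exact h'.comp (φ := fun x : Fin n → E => (x i, Function.update x i 0))
      ((measurable_pi_apply i).prodMk hup) measurable_id

end Independence

/-! ### Nets and the Gram form -/

section Net

/-- A 1/2-separated subset of the unit ball of largest cardinality is a net. Doubling it gives
1-separated points in the ball of radius 2, at most 5^dim in number. -/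
theorem exists_net (E : Type*) [NormedAddCommGroup E] [NormedSpace ℝ E]
    [FiniteDimensional ℝ E] :
    ∃ N : Finset E, N.card ≤ 5 ^ Module.finrank ℝ E ∧ (∀ v ∈ N, ‖v‖ ≤ 1) ∧
      ∀ u : E, ‖u‖ ≤ 1 → ∃ v ∈ N, ‖u - v‖ ≤ 1 / 2 := by
  classical
  let good : Finset E → Prop := fun s =>
    (∀ v ∈ s, ‖v‖ ≤ 1) ∧ ∀ v ∈ s, ∀ w ∈ s, v ≠ w → 1 / 2 ≤ ‖v - w‖
  have hcard : ∀ s, good s → s.card ≤ 5 ^ Module.finrank ℝ E := fun s hs => by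
    have hinj : Function.Injective fun v : E => (2:ℝ) • v := smul_right_injective E two_ne_zero
    rw [← Finset.card_image_of_injective s hinj]
    refine Besicovitch.card_le_of_separated _ (fun c hc => ?_) fun c hc d hd hcd => ?_
    · obtain ⟨v, hv, rfl⟩ := Finset.mem_image.1 hc
      rw [norm_smul, Real.norm_two]
      linarith [hs.1 v hv]
    · obtain ⟨v, hv, rfl⟩ := Finset.mem_image.1 hc
      obtain ⟨w, hw, rfl⟩ := Finset.mem_image.1 hd
      have := hs.2 v hv w hw fun h => hcd (by rw [h])
      rw [← smul_sub, norm_smul, Real.norm_two]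
      linarith
  let S : Set ℕ := {m | ∃ s, good s ∧ s.card = m}
  have hne : S.Nonempty := ⟨0, ∅, by simp [good], rfl⟩
  have hbdd : BddAbove S := ⟨_, fun m ⟨s, hs, hm⟩ => hm ▸ hcard s hs⟩
  obtain ⟨N, hN, hNm⟩ := Nat.sSup_mem hne hbdd
  refine ⟨N, hcard N hN, hN.1, fun u hu => ?_⟩
  by_contra! hc
  have huN : u ∉ N := fun h => by
    have := hc u h
    simp at this
    linarith
  have hins : good (insert u N) := by
    refine ⟨fun v hv => ?_, fun v hv w hw hvw => ?_⟩
    · rcases Finset.mem_insert.1 hv with rfl | hv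
      exacts [hu, hN.1 v hv]
    · rcases Finset.mem_insert.1 hv with rfl | hv' <;>
        rcases Finset.mem_insert.1 hw with rfl | hw'
      · exact absurd rfl hvw
      · exact (hc w hw').le
      · rw [norm_sub_rev]; exact (hc v hv').le
      · exact hN.2 v hv' w hw' hvw
  have := le_csSup hbdd (show (insert u N).card ∈ S from ⟨_, hins, rfl⟩)
  rw [Finset.card_insert_of_notMem huN, hNm] at this
  omega

/-- Approximating a unit vector by the net costs at most ‖L‖/2, which is absorbed on the left. -/
theorem opNorm_le_of_net {E F : Type*} [NormedAddCommGroup E] [NormedSpace ℝ E]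
    [NormedAddCommGroup F] [NormedSpace ℝ F] (L : E →L[ℝ] F) {N : Finset E}
    (hN : ∀ u : E, ‖u‖ ≤ 1 → ∃ v ∈ N, ‖u - v‖ ≤ 1 / 2) {b : ℝ} (hb : 0 ≤ b)
    (h : ∀ v ∈ N, ‖L v‖ ≤ b) : ‖L‖ ≤ 2 * b := by
  have key : ‖L‖ ≤ b + ‖L‖ / 2 := by
    refine L.opNorm_le_of_unit_norm (by positivity) fun u hu => ?_
    obtain ⟨v, hv, huv⟩ := hN u hu.le
    have e : L u = L v + L (u - v) := by rw [← map_add]; congr 1; abel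
    rw [e]
    refine (norm_add_le _ _).trans (add_le_add (h v hv) ((L.le_opNorm _).trans ?_))
    nlinarith [norm_nonneg L]
  linarith

theorem sum_inner_sq_le_of_net {n p : ℕ} (X : Fin n → EuclideanSpace ℝ (Fin p))
    {N : Finset (EuclideanSpace ℝ (Fin p))}
    (hN : ∀ u : EuclideanSpace ℝ (Fin p), ‖u‖ ≤ 1 → ∃ v ∈ N, ‖u - v‖ ≤ 1 / 2) {B : ℝ}
    (hB : 0 ≤ B) (h : ∀ v ∈ N, ∑ j, inner ℝ (X j) v ^ 2 ≤ B) (u : EuclideanSpace ℝ (Fin p)) :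
    ∑ j, inner ℝ (X j) u ^ 2 ≤ 4 * B * ‖u‖ ^ 2 := by
  let L : EuclideanSpace ℝ (Fin p) →L[ℝ] EuclideanSpace ℝ (Fin n) :=
    (EuclideanSpace.equiv (Fin n) ℝ).symm.toContinuousLinearMap ∘L
      ContinuousLinearMap.pi fun j => innerSL ℝ (X j)
  have hL : ∀ u, ‖L u‖ ^ 2 = ∑ j, inner ℝ (X j) u ^ 2 := fun u => by
    rw [EuclideanSpace.real_norm_sq_eq]
    rfl
  have h1 : ‖L‖ ≤ 2 * √B := opNorm_le_of_net L hN (Real.sqrt_nonneg _) fun v hv => by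
    refine Real.le_sqrt_of_sq_le ?_
    rw [hL]
    exact h v hv
  rw [← hL]
  calc ‖L u‖ ^ 2 ≤ (2 * √B * ‖u‖) ^ 2 := by
        have := (L.le_opNorm u).trans (mul_le_mul_of_nonneg_right h1 (norm_nonneg u))
        gcongr
    _ = 4 * B * ‖u‖ ^ 2 := by
        rw [mul_pow, mul_pow, Real.sq_sqrt hB]; norm_num

end Net

/-! ### The random bound -/

section RandomBound

variable {Ω : Type*} [MeasurableSpace Ω] {μ : Measure Ω} [IsProbabilityMeasure μ]
  {n p : ℕ} {ρ : ℝ → ℝ} {τ D lam A : ℝ} {M : ℕ}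
  {X : Fin n → Ω → EuclideanSpace ℝ (Fin p)} {ε : Fin n → Ω → ℝ}

/-- The unit vector in the direction of `v`, or `0`. -/
def direction {p : ℕ} (v : EuclideanSpace ℝ (Fin p)) : EuclideanSpace ℝ (Fin p) := ‖v‖⁻¹ • v

theorem norm_direction_le (v : EuclideanSpace ℝ (Fin p)) : ‖direction v‖ ≤ 1 := by
  rw [direction, norm_smul, norm_inv, norm_norm]
  exact inv_mul_le_one

theorem norm_smul_direction (v : EuclideanSpace ℝ (Fin p)) : ‖v‖ • direction v = v := by
  rcases eq_or_ne v 0 with rfl | h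
  · simp
  · rw [direction, smul_inv_smul₀ (norm_ne_zero_iff.2 h)]

theorem measurable_direction : Measurable (direction : EuclideanSpace ℝ (Fin p) → _) :=
  measurable_norm.inv.smul measurable_id

theorem abs_inner_le_of_direction {x v : EuclideanSpace ℝ (Fin p)} {T : ℝ} (hT : 1 ≤ T)
    (h : inner ℝ x (direction v) ^ 2 ≤ T) : |inner ℝ x v| ≤ T * ‖v‖ := by
  have h1 : |inner ℝ x (direction v)| ≤ T := abs_le_of_sq_le_sq (by nlinarith) (by linarith)
  have e : inner ℝ x v = ‖v‖ * inner ℝ x (direction v) := by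
    rw [← inner_smul_right, norm_smul_direction]
  rw [e, abs_mul, abs_norm, mul_comm]
  gcongr

/-- As v ignores observation i, it may be computed with X_i replaced by 0 and is then independent of
X_i; its direction can be frozen. -/
theorem lintegral_exp_direction_le (hX : ∀ i, Measurable (X i)) (hε : ∀ i, Measurable (ε i))
    (hind : iIndepFun X μ) (hXε : IndepFun (fun ω i => X i ω) (fun ω i => ε i ω) μ)
    (hA : ∀ i u, ‖u‖ ≤ 1 →
      ∫⁻ ω, ENNReal.ofReal (Real.exp (lam * inner ℝ (X i ω) u ^ 2)) ∂μ ≤ ENNReal.ofReal A)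
    (i : Fin n) {v : (Fin n → EuclideanSpace ℝ (Fin p)) × (Fin n → ℝ) → EuclideanSpace ℝ (Fin p)}
    (hv : Measurable v) (hvi : ∀ x e, v (Function.update x i 0, e) = v (x, e)) :
    ∫⁻ ω, ENNReal.ofReal (Real.exp (lam *
      inner ℝ (X i ω) (direction (v (fun j => X j ω, fun j => ε j ω))) ^ 2)) ∂μ
      ≤ ENNReal.ofReal A := by
  have hup : Measurable fun x : Fin n → EuclideanSpace ℝ (Fin p) => Function.update x i 0 :=
    measurable_update_left
  have h := lintegral_le_of_indepFun
    (g := fun x d => ENNReal.ofReal (Real.exp (lam * inner ℝ x (direction (v d)) ^ 2)))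
    (hX i) ((hup.comp (measurable_pi_lambda _ hX)).prodMk (measurable_pi_lambda _ hε))
    (indepFun_update hX hε hind hXε i)
    (by
      have := measurable_direction (p := p)
      unfold Function.uncurry
      fun_prop)
    (fun d => hA i _ (norm_direction_le _))
  simpa only [Function.comp_apply, hvi] using h

omit [IsProbabilityMeasure μ] in
theorem lintegral_exp_sum_le (hX : ∀ i, Measurable (X i)) (hind : iIndepFun X μ)
    (hA : ∀ i u, ‖u‖ ≤ 1 →
      ∫⁻ ω, ENNReal.ofReal (Real.exp (lam * inner ℝ (X i ω) u ^ 2)) ∂μ ≤ ENNReal.ofReal A)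
    (hA0 : 0 ≤ A) {u : EuclideanSpace ℝ (Fin p)} (hu : ‖u‖ ≤ 1) :
    ∫⁻ ω, ENNReal.ofReal (Real.exp (lam * ∑ i, inner ℝ (X i ω) u ^ 2)) ∂μ
      ≤ ENNReal.ofReal (A ^ n) := by
  have e : ∀ ω, ENNReal.ofReal (Real.exp (lam * ∑ i, inner ℝ (X i ω) u ^ 2))
      = ∏ i, ENNReal.ofReal (Real.exp (lam * inner ℝ (X i ω) u ^ 2)) := fun ω => by
    rw [Finset.mul_sum, Real.exp_sum, ENNReal.ofReal_prod_of_nonneg fun i _ => (Real.exp_pos _).le]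
  have hm : Measurable fun x : EuclideanSpace ℝ (Fin p) =>
    ENNReal.ofReal (Real.exp (lam * inner ℝ x u ^ 2)) := by fun_prop
  simp only [e]
  rw [lintegral_prod_eq_prod_lintegral_of_indepFun Finset.univ
    (fun i ω => ENNReal.ofReal (Real.exp (lam * inner ℝ (X i ω) u ^ 2)))
    (hind.comp (fun _ x => ENNReal.ofReal (Real.exp (lam * inner ℝ x u ^ 2))) fun _ => hm)
    fun i => hm.comp (hX i), ENNReal.ofReal_pow hA0]
  calc _ ≤ ∏ _i : Fin n, ENNReal.ofReal A := Finset.prod_le_prod' fun i _ => hA i u hu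
    _ = _ := by simp

set_option maxHeartbeats 400000 in
/-- The data are bounded by a random variable whose parts have explicit exponential moments. -/
theorem exists_dataBound (h0 : 0 < n) (hρ : IsPolyLoss ρ D M) (hτ : 0 < τ) (hX : ∀ i, Measurable (X i))
    (hε : ∀ i, Measurable (ε i)) (hind : iIndepFun X μ)
    (hXε : IndepFun (fun ω i => X i ω) (fun ω i => ε i ω) μ) (hlam : 0 < lam) (hA1 : 1 ≤ A)
    (hA : ∀ i u, ‖u‖ ≤ 1 →
      ∫⁻ ω, ENNReal.ofReal (Real.exp (lam * inner ℝ (X i ω) u ^ 2)) ∂μ ≤ ENNReal.ofReal A) :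
    ∃ Y₁ Y₂ : Ω → ℝ, Measurable Y₁ ∧ Measurable Y₂ ∧ (∀ ω, 0 ≤ Y₁ ω) ∧ (∀ ω, 0 ≤ Y₂ ω) ∧
      ∫⁻ ω, ENNReal.ofReal (Real.exp (Y₁ ω)) ∂μ ≤ ENNReal.ofReal (1 + (n + n * n) * A) ∧
      ∫⁻ ω, ENNReal.ofReal (Real.exp (Y₂ ω)) ∂μ ≤ ENNReal.ofReal (1 + 5 ^ p * A ^ n) ∧
      ∀ ω, DataBound ρ τ (fun j => X j ω) (fun j => ε j ω)
        (1 + (⨆ j, |ε j ω|) + lam⁻¹ * Y₁ ω + 4 / (lam * n) * Y₂ ω) := by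
  have hA0 : 0 ≤ A := by linarith
  have hdata : Measurable fun ω => ((fun j => X j ω : Fin n → EuclideanSpace ℝ (Fin p)),
      (fun j => ε j ω : Fin n → ℝ)) :=
    (measurable_pi_lambda _ hX).prodMk (measurable_pi_lambda _ hε)
  have hb : ∀ i, Measurable fun d : (Fin n → EuclideanSpace ℝ (Fin p)) × (Fin n → ℝ) =>
    betaLoo ρ τ d.1 d.2 i := fun i => (continuous_betaLoo hρ.isLoss hτ i).measurable
  have hr : ∀ i j, Measurable fun d : (Fin n → EuclideanSpace ℝ (Fin p)) × (Fin n → ℝ) =>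
    resolvent ρ τ d.1 d.2 i (d.1 j) := fun i j =>
    (continuous_resolvent hρ hτ i (by fun_prop)).measurable
  obtain ⟨N, hNc, hN1, hN⟩ := exists_net (EuclideanSpace ℝ (Fin p))
  rw [finrank_euclideanSpace_fin] at hNc
  obtain ⟨U₁, hU₁⟩ : ∃ U : Fin n → Ω → ℝ, U = fun i ω => Real.exp (lam * inner ℝ (X i ω)
    (direction (betaLoo ρ τ (fun l => X l ω) (fun l => ε l ω) i)) ^ 2) := ⟨_, rfl⟩
  obtain ⟨U₂, hU₂⟩ : ∃ U : Fin n → Fin n → Ω → ℝ, U = fun i j ω => Real.exp (lam *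
    inner ℝ (X i ω) (direction (resolvent ρ τ (fun l => X l ω) (fun l => ε l ω) i (X j ω))) ^ 2) :=
    ⟨_, rfl⟩
  obtain ⟨U₃, hU₃⟩ : ∃ U : EuclideanSpace ℝ (Fin p) → Ω → ℝ, U = fun v ω =>
    Real.exp (lam * ∑ i, inner ℝ (X i ω) v ^ 2) := ⟨_, rfl⟩
  have mU₁ : ∀ i, Measurable (U₁ i) := fun i => by
    have := measurable_direction.comp ((hb i).comp hdata)
    simp only [Function.comp_def] at this
    simp only [hU₁]
    fun_prop
  have mU₂ : ∀ i j, Measurable (U₂ i j) := fun i j => by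
    have := measurable_direction.comp ((hr i j).comp hdata)
    simp only [Function.comp_def] at this
    simp only [hU₂]
    fun_prop
  have mU₃ : ∀ v, Measurable (U₃ v) := fun v => by
    simp only [hU₃]
    fun_prop
  have pU₁ : ∀ i ω, 0 ≤ U₁ i ω := fun i ω => by rw [hU₁]; exact (Real.exp_pos _).le
  have pU₂ : ∀ i j ω, 0 ≤ U₂ i j ω := fun i j ω => by rw [hU₂]; exact (Real.exp_pos _).le
  have pU₃ : ∀ v ω, 0 ≤ U₃ v ω := fun v ω => by rw [hU₃]; exact (Real.exp_pos _).le
  have iU₁ : ∀ i, ∫⁻ ω, ENNReal.ofReal (U₁ i ω) ∂μ ≤ ENNReal.ofReal A := fun i => by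
    rw [hU₁]
    exact lintegral_exp_direction_le hX hε hind hXε hA i (v := fun d => betaLoo ρ τ d.1 d.2 i) (hb i)
      fun x e => betaLoo_update ρ τ x e i 0
  have iU₂ : ∀ i j, j ≠ i → ∫⁻ ω, ENNReal.ofReal (U₂ i j ω) ∂μ ≤ ENNReal.ofReal A := fun i j hj => by
    rw [hU₂]
    exact lintegral_exp_direction_le hX hε hind hXε hA i
      (v := fun d => resolvent ρ τ d.1 d.2 i (d.1 j)) (hr i j)
      fun x e => by simp only [resolvent_update, Function.update_of_ne hj]
  have iU₃ : ∀ v ∈ N, ∫⁻ ω, ENNReal.ofReal (U₃ v ω) ∂μ ≤ ENNReal.ofReal (A ^ n) := fun v hv => by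
    rw [hU₃]
    exact lintegral_exp_sum_le hX hind hA hA0 (hN1 v hv)
  -- Sums stand in for maxima, so that expectations add up; the extra 1 keeps the logarithms
  -- nonnegative.
  obtain ⟨W₁, hW₁⟩ : ∃ W : Ω → ℝ, W = fun ω =>
    1 + (∑ i, U₁ i ω + ∑ i, ∑ j ∈ Finset.univ.erase i, U₂ i j ω) := ⟨_, rfl⟩
  obtain ⟨W₂, hW₂⟩ : ∃ W : Ω → ℝ, W = fun ω => 1 + ∑ v ∈ N, U₃ v ω := ⟨_, rfl⟩
  have s1 : ∀ ω, 0 ≤ ∑ i, U₁ i ω := fun ω => Finset.sum_nonneg fun i _ => pU₁ i ω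
  have s2' : ∀ ω i, 0 ≤ ∑ j ∈ Finset.univ.erase i, U₂ i j ω := fun ω i =>
    Finset.sum_nonneg fun j _ => pU₂ i j ω
  have s2 : ∀ ω, 0 ≤ ∑ i, ∑ j ∈ Finset.univ.erase i, U₂ i j ω := fun ω =>
    Finset.sum_nonneg fun i _ => s2' ω i
  have s3 : ∀ ω, 0 ≤ ∑ v ∈ N, U₃ v ω := fun ω => Finset.sum_nonneg fun v _ => pU₃ v ω
  have W₁1 : ∀ ω, 1 ≤ W₁ ω := fun ω => by simp only [hW₁]; linarith [s1 ω, s2 ω]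
  have W₂1 : ∀ ω, 1 ≤ W₂ ω := fun ω => by simp only [hW₂]; linarith [s3 ω]
  refine ⟨fun ω => Real.log (W₁ ω), fun ω => Real.log (W₂ ω), ?_, ?_,
    fun ω => Real.log_nonneg (W₁1 ω), fun ω => Real.log_nonneg (W₂1 ω), ?_, ?_, fun ω => ?_⟩
  · simp only [hW₁]
    fun_prop
  · simp only [hW₂]
    fun_prop
  · have e : ∀ ω, ENNReal.ofReal (Real.exp (Real.log (W₁ ω))) = 1 + (∑ i, ENNReal.ofReal (U₁ i ω)
        + ∑ i, ∑ j ∈ Finset.univ.erase i, ENNReal.ofReal (U₂ i j ω)) := fun ω => by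
      rw [Real.exp_log (by linarith [W₁1 ω])]
      simp only [hW₁]
      rw [ENNReal.ofReal_add zero_le_one (add_nonneg (s1 ω) (s2 ω)), ENNReal.ofReal_one,
        ENNReal.ofReal_add (s1 ω) (s2 ω), ENNReal.ofReal_sum_of_nonneg fun i _ => pU₁ i ω,
        ENNReal.ofReal_sum_of_nonneg fun i _ => s2' ω i]
      simp only [ENNReal.ofReal_sum_of_nonneg fun j _ => pU₂ _ j ω]
    simp only [e]
    rw [lintegral_add_left measurable_const, lintegral_const, measure_univ, mul_one,
      lintegral_add_left (by fun_prop), lintegral_finsetSum _ (by fun_prop),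
      lintegral_finsetSum _ (by fun_prop)]
    simp only [fun i => lintegral_finsetSum (μ := μ) (Finset.univ.erase i)
      fun j _ => (mU₂ i j).ennreal_ofReal]
    rw [add_mul, ENNReal.ofReal_add zero_le_one (by positivity), ENNReal.ofReal_one,
      ENNReal.ofReal_add (by positivity) (by positivity)]
    gcongr
    · calc _ ≤ ∑ _i : Fin n, ENNReal.ofReal A := Finset.sum_le_sum fun i _ => iU₁ i
        _ = _ := by
          rw [Finset.sum_const, Finset.card_univ, Fintype.card_fin, nsmul_eq_mul,
            ENNReal.ofReal_mul (by positivity), ENNReal.ofReal_natCast]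
    · calc _ ≤ ∑ _i : Fin n, ∑ _j : Fin n, ENNReal.ofReal A := Finset.sum_le_sum fun i _ =>
            (Finset.sum_le_sum fun j hj => iU₂ i j (Finset.ne_of_mem_erase hj)).trans
              (Finset.sum_le_sum_of_subset (Finset.subset_univ _))
        _ = _ := by
          simp only [Finset.sum_const, Finset.card_univ, Fintype.card_fin, nsmul_eq_mul]
          rw [ENNReal.ofReal_mul (by positivity), ENNReal.ofReal_mul (by positivity),
            ENNReal.ofReal_natCast, mul_assoc]
  · have e : ∀ ω, ENNReal.ofReal (Real.exp (Real.log (W₂ ω)))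
        = 1 + ∑ v ∈ N, ENNReal.ofReal (U₃ v ω) := fun ω => by
      rw [Real.exp_log (by linarith [W₂1 ω])]
      simp only [hW₂]
      rw [ENNReal.ofReal_add zero_le_one (s3 ω), ENNReal.ofReal_one,
        ENNReal.ofReal_sum_of_nonneg fun v _ => pU₃ v ω]
    simp only [e]
    rw [lintegral_add_left measurable_const, lintegral_const, measure_univ, mul_one,
      lintegral_finsetSum _ (by fun_prop), ENNReal.ofReal_add zero_le_one (by positivity),
      ENNReal.ofReal_one]
    gcongr
    calc _ ≤ ∑ _v ∈ N, ENNReal.ofReal (A ^ n) := Finset.sum_le_sum fun v hv => iU₃ v hv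
      _ = ENNReal.ofReal (N.card * A ^ n) := by
        rw [Finset.sum_const, nsmul_eq_mul, ENNReal.ofReal_mul (by positivity),
          ENNReal.ofReal_natCast]
      _ ≤ _ := by
        refine ENNReal.ofReal_le_ofReal (mul_le_mul_of_nonneg_right ?_ (by positivity))
        exact_mod_cast hNc
  · have hY₁ := Real.log_nonneg (W₁1 ω)
    have hY₂ := Real.log_nonneg (W₂1 ω)
    have hS : 0 ≤ ⨆ j, |ε j ω| := Real.iSup_nonneg fun j => abs_nonneg _
    have t1 : 0 ≤ lam⁻¹ * Real.log (W₁ ω) := by positivity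
    have t2 : 0 ≤ 4 / (lam * n) * Real.log (W₂ ω) := by positivity
    have hle : ∀ {z W : ℝ}, Real.exp (lam * z) ≤ W → z ≤ lam⁻¹ * Real.log W := fun {z W} h => by
      rw [le_inv_mul_iff₀ hlam]
      exact (Real.le_log_iff_exp_le ((Real.exp_pos _).trans_le h)).2 h
    refine ⟨by linarith, fun j => ?_, fun u => ?_, fun i => ?_, fun i j hj => ?_⟩
    · have := le_ciSup (f := fun j => |ε j ω|) (Set.finite_range _).bddAbove j
      simp only at this ⊢
      linarith
    · have h1 := sum_inner_sq_le_of_net (fun j => X j ω) hN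
        (B := lam⁻¹ * Real.log (W₂ ω)) (by positivity) (fun v hv => hle (by
          have := Finset.single_le_sum (f := fun v => U₃ v ω) (fun v _ => pU₃ v ω) hv
          simp only [hW₂]
          simp only [hU₃] at this ⊢
          linarith)) u
      refine h1.trans (mul_le_mul_of_nonneg_right ?_ (by positivity))
      have hn : (0:ℝ) < n := by exact_mod_cast h0
      have e1 : 4 * (lam⁻¹ * Real.log (W₂ ω)) = n * (4 / (lam * n) * Real.log (W₂ ω)) := by
        field_simp
      rw [e1]
      refine mul_le_mul_of_nonneg_left ?_ hn.le
      linarith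
    · refine abs_inner_le_of_direction (by linarith) ((hle (W := W₁ ω) ?_).trans (by linarith))
      have := Finset.single_le_sum (f := fun i => U₁ i ω) (fun i _ => pU₁ i ω) (Finset.mem_univ i)
      simp only [hW₁]
      simp only [hU₁] at this ⊢
      linarith [s2 ω]
    · refine abs_inner_le_of_direction (by linarith) ((hle (W := W₁ ω) ?_).trans (by linarith))
      have h1 := Finset.single_le_sum (f := fun j => U₂ i j ω) (fun j _ => pU₂ i j ω)
        (Finset.mem_erase.2 ⟨hj, Finset.mem_univ j⟩)
      have h2 := Finset.single_le_sum (f := fun i => ∑ j ∈ Finset.univ.erase i, U₂ i j ω)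
        (fun i _ => s2' ω i) (Finset.mem_univ i)
      have h3 := h1.trans h2
      simp only [hW₁]
      simp only [hU₂] at h3 ⊢
      linarith [s1 ω, s2 ω]

end RandomBound

/-! ### Powers of the logarithm -/

theorem eventually_one_le_log : ∀ᶠ n : ℕ in atTop, 1 ≤ Real.log n :=
  (Real.tendsto_log_atTop.comp tendsto_natCast_atTop_atTop).eventually_ge_atTop 1

/-- `f n` is at most of the order of a power of `log n`. -/
def PolyLog (f : ℕ → ℝ) : Prop := ∃ a : ℕ, f =O[atTop] fun n : ℕ => Real.log n ^ a

theorem isBigO_log_pow {a b : ℕ} (h : a ≤ b) :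
    (fun n : ℕ => Real.log n ^ a) =O[atTop] fun n : ℕ => Real.log n ^ b := by
  refine IsBigO.of_bound 1 ?_
  filter_upwards [eventually_one_le_log] with n hn
  rw [one_mul, Real.norm_of_nonneg (by positivity), Real.norm_of_nonneg (by positivity)]
  exact pow_le_pow_right₀ hn h

namespace PolyLog

variable {f g : ℕ → ℝ}

theorem const (c : ℝ) : PolyLog fun _ => c :=
  ⟨0, by simpa using isBigO_const_const c (one_ne_zero (α := ℝ)) atTop⟩

theorem log : PolyLog fun n => Real.log n := ⟨1, by simpa using isBigO_refl _ _⟩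

theorem add (hf : PolyLog f) (hg : PolyLog g) : PolyLog fun n => f n + g n := by
  obtain ⟨a, ha⟩ := hf
  obtain ⟨b, hb⟩ := hg
  exact ⟨a + b, (ha.trans (isBigO_log_pow (by omega))).add (hb.trans (isBigO_log_pow (by omega)))⟩

theorem mul (hf : PolyLog f) (hg : PolyLog g) : PolyLog fun n => f n * g n := by
  obtain ⟨a, ha⟩ := hf
  obtain ⟨b, hb⟩ := hg
  refine ⟨a + b, ?_⟩
  simpa only [pow_add] using ha.mul hb

theorem of_isBigO (hg : PolyLog g) (h : f =O[atTop] g) : PolyLog f := by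
  obtain ⟨b, hb⟩ := hg
  exact ⟨b, h.trans hb⟩

theorem of_le (hg : PolyLog g) (h : ∀ᶠ n in atTop, 0 ≤ f n ∧ f n ≤ g n) : PolyLog f := by
  refine hg.of_isBigO (IsBigO.of_bound 1 ?_)
  filter_upwards [h] with n hn
  rw [one_mul, Real.norm_of_nonneg hn.1]
  exact hn.2.trans (le_abs_self _)

theorem log_rpow (α : ℝ) : PolyLog fun n => Real.log n ^ α := by
  refine of_le (g := fun n => Real.log n ^ ⌈|α|⌉₊) ⟨_, isBigO_refl _ _⟩ ?_
  filter_upwards [eventually_one_le_log] with n hn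
  refine ⟨by positivity, ?_⟩
  rw [← Real.rpow_natCast]
  exact Real.rpow_le_rpow_of_exponent_le hn ((le_abs_self α).trans (Nat.le_ceil _))

theorem exists_le (hf : PolyLog f) :
    ∃ (a : ℕ) (K : ℝ), 0 ≤ K ∧ ∀ᶠ n : ℕ in atTop, f n ≤ K * Real.log n ^ a := by
  obtain ⟨a, ha⟩ := hf
  obtain ⟨K, hK0, hK⟩ := ha.exists_nonneg
  refine ⟨a, K, hK0, ?_⟩
  filter_upwards [hK.bound, eventually_one_le_log] with n hn h1
  rw [Real.norm_of_nonneg (by positivity : 0 ≤ Real.log n ^ a)] at hn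
  exact (le_abs_self _).trans hn

end PolyLog

/-! ### Arrays of random variables -/

section Array

variable {Ω : ℕ → Type*} [∀ n, MeasurableSpace (Ω n)] {P : ∀ n, Measure (Ω n)}
  [∀ n, IsProbabilityMeasure (P n)] {Z Z' : ∀ n, Ω n → ℝ}

/-- All the `L_k` norms of `Z n` are of the order of one power of `log n`. -/
def MomentPolyLog (P : ∀ n, Measure (Ω n)) (Z : ∀ n, Ω n → ℝ) : Prop :=
  ∃ a : ℕ, ∀ k : ℕ, 1 ≤ k → BigOLk P k Z fun n => Real.log n ^ a

namespace MomentPolyLog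

omit [∀ n, IsProbabilityMeasure (P n)] in
theorem of_eLpNorm_le {f : ℕ → ℝ} (hf : PolyLog f) (h : ∀ k : ℕ, 1 ≤ k → ∃ K : ℝ, 0 ≤ K ∧
    ∀ᶠ n in atTop, AEStronglyMeasurable (Z n) (P n) ∧
      eLpNorm (Z n) k (P n) ≤ ENNReal.ofReal (K * f n)) : MomentPolyLog P Z := by
  obtain ⟨a, K', hK', hf⟩ := hf.exists_le
  refine ⟨a, fun k hk => ?_⟩
  obtain ⟨K, hK0, hK⟩ := h k hk
  refine ⟨K * K', ?_⟩
  filter_upwards [hK, hf] with n hn hfn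
  refine ⟨⟨hn.1, hn.2.trans_lt ENNReal.ofReal_lt_top⟩, hn.2.trans (ENNReal.ofReal_le_ofReal ?_)⟩
  rw [mul_assoc]
  gcongr

omit [∀ n, IsProbabilityMeasure (P n)] in
theorem add (h : MomentPolyLog P Z) (h' : MomentPolyLog P Z') :
    MomentPolyLog P fun n ω => Z n ω + Z' n ω := by
  obtain ⟨a, ha⟩ := h
  obtain ⟨b, hb⟩ := h'
  refine ⟨a + b, fun k hk => ?_⟩
  obtain ⟨K, hK⟩ := ha k hk
  obtain ⟨K', hK'⟩ := hb k hk
  refine ⟨|K| + |K'|, ?_⟩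
  filter_upwards [hK, hK', eventually_one_le_log] with n hn hn' hl
  refine ⟨hn.1.add hn'.1, (eLpNorm_add_le hn.1.1 hn'.1.1 (by exact_mod_cast hk)).trans
    ((add_le_add hn.2 hn'.2).trans ?_)⟩
  have h1 : K * Real.log n ^ a ≤ |K| * Real.log n ^ (a + b) :=
    mul_le_mul (le_abs_self K) (pow_le_pow_right₀ hl (by omega)) (by positivity) (abs_nonneg _)
  have h2 : K' * Real.log n ^ b ≤ |K'| * Real.log n ^ (a + b) :=
    mul_le_mul (le_abs_self K') (pow_le_pow_right₀ hl (by omega)) (by positivity) (abs_nonneg _)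
  rw [add_mul, ENNReal.ofReal_add (by positivity) (by positivity)]
  exact add_le_add (ENNReal.ofReal_le_ofReal h1) (ENNReal.ofReal_le_ofReal h2)

theorem one : MomentPolyLog P fun _ _ => 1 :=
  of_eLpNorm_le (PolyLog.const 1) fun k hk => ⟨1, zero_le_one, Eventually.of_forall fun n => by
    refine ⟨aestronglyMeasurable_const, ?_⟩
    rw [eLpNorm_const _ (by simp; omega) (NeZero.ne _)]
    simp⟩

/-- Random variables with exponential moments of order `A n` are of the order of `log (A n)`. -/
theorem of_exp {s A : ℕ → ℝ} (hZ : ∀ᶠ n in atTop, Measurable (Z n) ∧ (∀ ω, 0 ≤ Z n ω) ∧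
      ∫⁻ ω, ENNReal.ofReal (Real.exp (Z n ω)) ∂(P n) ≤ ENNReal.ofReal (A n))
    (hA : ∀ᶠ n in atTop, 1 ≤ A n) (hs : ∀ᶠ n in atTop, 0 ≤ s n)
    (h : PolyLog fun n => s n * (Real.log (A n) + 1)) :
    MomentPolyLog P fun n ω => s n * Z n ω := by
  refine of_eLpNorm_le h fun k hk => ⟨2 * k.factorial, by positivity, ?_⟩
  filter_upwards [hZ, hA, hs] with n hn hAn hsn
  refine ⟨(hn.1.const_mul _).aestronglyMeasurable, ?_⟩
  have h1 := eLpNorm_le_of_exp hn.1 hn.2.1 hAn hn.2.2 hk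
  have hl := Real.log_nonneg hAn
  have hk1 : (1:ℝ) ≤ k.factorial := by exact_mod_cast k.factorial_pos
  change eLpNorm (s n • Z n) k (P n) ≤ _
  rw [eLpNorm_const_smul, Real.enorm_eq_ofReal hsn]
  calc _ ≤ ENNReal.ofReal (s n) * ENNReal.ofReal (2 * (Real.log (A n) + k.factorial)) := by gcongr
    _ = ENNReal.ofReal (s n * (2 * (Real.log (A n) + k.factorial))) :=
        (ENNReal.ofReal_mul hsn).symm
    _ ≤ _ := by
        refine ENNReal.ofReal_le_ofReal ?_
        have : Real.log (A n) + k.factorial ≤ k.factorial * (Real.log (A n) + 1) := by nlinarith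
        calc _ ≤ s n * (2 * (k.factorial * (Real.log (A n) + 1))) := by gcongr
          _ = _ := by ring

omit [∀ n, IsProbabilityMeasure (P n)] in
/-- Everything that is polynomially controlled by `Z n` inherits its order, uniformly. -/
theorem exists_eLpNorm_le (hZ : MomentPolyLog P Z) (h1 : ∀ᶠ n in atTop, ∀ ω, 1 ≤ Z n ω)
    {f : ℝ → ℝ} (hf : PolyBdd f) :
    ∃ b : ℕ, ∀ k : ℕ, 1 ≤ k → ∃ K : ℝ, 0 ≤ K ∧ ∀ᶠ n : ℕ in atTop, ∀ (Y : Ω n → ℝ) (r : ℝ), 0 ≤ r →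
      Measurable Y → (∀ ω, |Y ω| ≤ f (Z n ω) * r) →
      MemLp Y k (P n) ∧ eLpNorm Y k (P n) ≤ ENNReal.ofReal (K * Real.log n ^ b * r) := by
  obtain ⟨C, M, hC, hf⟩ := hf
  obtain ⟨a, ha⟩ := hZ
  -- The L_k norm of Z^(M+1) is the (M+1)-th power of the L_{k(M+1)} norm of Z, so the exponent does
  -- not depend on k. Taking M + 1 instead of M keeps the moment order positive when M = 0.
  refine ⟨a * (M + 1), fun k hk => ?_⟩
  obtain ⟨K, hK⟩ := ha (k * (M + 1)) (Nat.mul_pos hk M.succ_pos)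
  refine ⟨C * |K| ^ (M + 1), by positivity, ?_⟩
  filter_upwards [hK, h1, eventually_one_le_log] with n hn h1n hl Y r hr hY hle
  have hb : eLpNorm Y k (P n) ≤ ENNReal.ofReal (C * |K| ^ (M + 1) * Real.log n ^ (a * (M + 1)) * r) := by
    calc eLpNorm Y k (P n) ≤ eLpNorm ((C * r) • fun ω => ‖Z n ω‖ ^ ((M + 1 : ℕ) : ℝ)) k (P n) := by
          refine eLpNorm_mono_real fun ω => (hle ω).trans ?_
          have h2 := h1n ω
          simp only [Pi.smul_apply, smul_eq_mul, Real.rpow_natCast]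
          rw [Real.norm_of_nonneg (by linarith)]
          have h3 : Z n ω ^ M ≤ Z n ω ^ (M + 1) := pow_le_pow_right₀ h2 (by omega)
          calc f (Z n ω) * r ≤ (C * Z n ω ^ (M + 1)) * r := by
                refine mul_le_mul_of_nonneg_right ((hf _ h2).2.trans ?_) hr
                gcongr
            _ = _ := by ring
      _ = ENNReal.ofReal (C * r) * eLpNorm (Z n) ((k * (M + 1) : ℕ) : ENNReal) (P n) ^ (M + 1) := by
          rw [eLpNorm_const_smul, Real.enorm_eq_ofReal (by positivity),
            eLpNorm_norm_rpow _ (by positivity), ENNReal.ofReal_natCast, ENNReal.rpow_natCast]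
          norm_cast
      _ ≤ ENNReal.ofReal (C * r) * ENNReal.ofReal (|K| * Real.log n ^ a) ^ (M + 1) := by
          gcongr
          refine hn.2.trans (ENNReal.ofReal_le_ofReal ?_)
          exact mul_le_mul_of_nonneg_right (le_abs_self K) (by positivity)
      _ = _ := by
          rw [← ENNReal.ofReal_pow (by positivity), ← ENNReal.ofReal_mul (by positivity)]
          congr 1
          rw [mul_pow, pow_mul]
          ring
  exact ⟨⟨hY.aestronglyMeasurable, hb.trans_lt ENNReal.ofReal_lt_top⟩, hb⟩

end MomentPolyLog

theorem integral_sq_le_of_eLpNorm_le {Ω : Type*} [MeasurableSpace Ω] {μ : Measure Ω} {Y : Ω → ℝ}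
    {B : ℝ} (hB : 0 ≤ B) (hY : MemLp Y 2 μ) (h : eLpNorm Y 2 μ ≤ ENNReal.ofReal B) :
    ∫ ω, Y ω ^ 2 ∂μ ≤ B ^ 2 := by
  rw [hY.eLpNorm_eq_integral_rpow_norm two_ne_zero ENNReal.ofNat_ne_top,
    ENNReal.ofReal_le_ofReal_iff hB] at h
  simp only [ENNReal.toReal_ofNat, Real.rpow_ofNat, Real.norm_eq_abs, sq_abs] at h
  have h0 : 0 ≤ ∫ ω, Y ω ^ 2 ∂μ := integral_nonneg fun ω => sq_nonneg _
  rw [show (2:ℝ)⁻¹ = 1 / 2 by norm_num, ← Real.sqrt_eq_rpow] at h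
  exact (Real.sqrt_le_left hB).1 h

end Array

/-! ### The array bound -/

section Main

variable {Ω : ℕ → Type*} [∀ n, MeasurableSpace (Ω n)] {P : ∀ n, Measure (Ω n)}
  [∀ n, IsProbabilityMeasure (P n)] {ρ : ℝ → ℝ} {τ D : ℝ} {M : ℕ} {p : ℕ → ℕ}
  {X : ∀ n, Fin n → Ω n → EuclideanSpace ℝ (Fin (p n))} {ε : ∀ n, Fin n → Ω n → ℝ}

theorem IsDesign.exists_expMoment (hX : IsDesign P p X) :
    ∃ lam A : ℕ → ℝ, (∀ n, 0 < lam n) ∧ (∀ n, 1 ≤ A n) ∧ (PolyLog fun n => (lam n)⁻¹) ∧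
      (PolyLog fun n => Real.log (A n)) ∧ ∀ n i (u : EuclideanSpace ℝ (Fin (p n))), ‖u‖ ≤ 1 →
        ∫⁻ ω, ENNReal.ofReal (Real.exp (lam n * inner ℝ (X n i ω) u ^ 2)) ∂(P n)
          ≤ ENNReal.ofReal (A n) := by
  obtain ⟨C, c, hc, ⟨α, -, hα⟩, ⟨K, α', hK⟩, hconc⟩ := hX.concentration
  -- These are the constants of `lintegral_exp_sq_le`, with c truncated at 1 and C made nonnegative.
  -- It is applied to x ↦ ⟨x, u⟩, which is convex and 1-Lipschitz for ‖u‖ ≤ 1.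
  refine ⟨fun n => min (c n) 1 / 4, fun n => Real.exp 5 * (1 + max (C n) 0) ^ 5,
    fun n => by have := hc n; positivity, fun n => ?_, ?_, ?_, fun n i u hu => ?_⟩
  · have h1 : (1:ℝ) ≤ Real.exp 5 := Real.one_le_exp (by norm_num)
    have h2 : (1:ℝ) ≤ (1 + max (C n) 0) ^ 5 := one_le_pow₀ (by linarith [le_max_right (C n) 0])
    nlinarith
  · refine PolyLog.of_le (g := fun n => 4 * ((c n)⁻¹ + 1)) ((PolyLog.const 4).mul
      (((PolyLog.log_rpow α).of_isBigO hα).add (PolyLog.const 1))) (Eventually.of_forall fun n => ?_)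
    have h0 := hc n
    refine ⟨by positivity, ?_⟩
    rw [inv_div, div_eq_mul_inv]
    gcongr
    rcases le_total (c n) 1 with h | h
    · rw [min_eq_left h]; linarith
    · rw [min_eq_right h, inv_one]
      have : 0 < (c n)⁻¹ := inv_pos.2 h0
      linarith
  · refine PolyLog.of_le (g := fun n => 5 + 5 * (Real.log 2 + |K| * Real.log n ^ α'))
      ((PolyLog.const 5).add ((PolyLog.const 5).mul ((PolyLog.const _).add
        ((PolyLog.const _).mul (PolyLog.log_rpow α'))))) ?_
    filter_upwards [hK, eventually_one_le_log] with n hn hl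
    have hm := le_max_right (C n) 0
    have e : Real.log (Real.exp 5 * (1 + max (C n) 0) ^ 5)
        = 5 + 5 * Real.log (1 + max (C n) 0) := by
      rw [Real.log_mul (Real.exp_pos _).ne' (by positivity), Real.log_exp, Real.log_pow]
      norm_num
    rw [e]
    have h0 : 0 ≤ Real.log (1 + max (C n) 0) := Real.log_nonneg (by linarith)
    refine ⟨by positivity, ?_⟩
    gcongr
    have hq : 0 ≤ |K| * Real.log n ^ α' := by positivity
    rw [Real.log_le_iff_le_exp (by linarith), Real.exp_add, Real.exp_log two_pos]
    have h1 : Real.exp (K * Real.log n ^ α') ≤ Real.exp (|K| * Real.log n ^ α') :=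
      Real.exp_le_exp.2 (mul_le_mul_of_nonneg_right (le_abs_self K) (by positivity))
    have h2 := Real.one_le_exp hq
    have h3 : max (C n) 0 ≤ Real.exp (|K| * Real.log n ^ α') :=
      max_le (hn.trans h1) (Real.exp_pos _).le
    linarith
  · have hlip : LipschitzWith 1 fun x : EuclideanSpace ℝ (Fin (p n)) => inner ℝ x u := by
      refine LipschitzWith.of_dist_le_mul fun x y => ?_
      rw [Real.dist_eq, ← inner_sub_left, dist_eq_norm, NNReal.coe_one, one_mul]
      refine (abs_real_inner_le_norm _ _).trans ?_
      exact mul_le_of_le_one_right (norm_nonneg _) hu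
    have hconv : ConvexOn ℝ univ fun x : EuclideanSpace ℝ (Fin (p n)) => inner ℝ x u := by
      refine ⟨convex_univ, fun x _ y _ a b _ _ _ => le_of_eq ?_⟩
      simp only [inner_add_left, inner_smul_left, conj_trivial, smul_eq_mul]
    obtain ⟨m, hm⟩ := hconc n _ hlip hconv i
    have hmX := hX.measurable n i
    refine lintegral_exp_sq_le (by fun_prop) (m := m) (le_max_right _ _)
      (lt_min (hc n) one_pos) (min_le_right _ _) (fun t ht => (hm t ht).trans ?_) ?_
    · refine mul_le_mul (le_max_left _ _) (Real.exp_le_exp.2 ?_) (Real.exp_pos _).le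
        (le_max_right _ _)
      nlinarith [min_le_left (c n) 1, sq_nonneg t,
        mul_le_mul_of_nonneg_right (min_le_left (c n) 1) (sq_nonneg t)]
    · rw [lintegral_inner_sq (hX.memLp n i) (hX.mean n i) (hX.cov n i), ← ENNReal.ofReal_one]
      exact ENNReal.ofReal_le_ofReal (pow_le_one₀ (norm_nonneg _) hu)

theorem exists_array_dataBound (hτ : 0 < τ)
    (hp : ∃ κ : ℝ, 0 < κ ∧ Tendsto (fun n : ℕ => (p n : ℝ) / n) atTop (𝓝 κ))
    (hρ : IsPolyLoss ρ D M) (hX : IsDesign P p X)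
    (hXε : ∀ n, IndepFun (fun ω i => X n i ω) (fun ω i => ε n i ω) (P n))
    (hε : IsErrors P ρ ε) :
    ∃ T : ∀ n, Ω n → ℝ, MomentPolyLog P T ∧ ∀ᶠ n in atTop, ∀ ω,
      DataBound ρ τ (fun j => X n j ω) (fun j => ε n j ω) (T n ω) := by
  obtain ⟨lam, A, hlam, hA1, hPlam, hPA, hA⟩ := hX.exists_expMoment
  have hex : ∀ n, ∃ Y₁ Y₂ : Ω n → ℝ, 0 < n → Measurable Y₁ ∧ Measurable Y₂ ∧
      (∀ ω, 0 ≤ Y₁ ω) ∧ (∀ ω, 0 ≤ Y₂ ω) ∧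
      ∫⁻ ω, ENNReal.ofReal (Real.exp (Y₁ ω)) ∂(P n)
        ≤ ENNReal.ofReal (1 + (n + n * n) * A n) ∧
      ∫⁻ ω, ENNReal.ofReal (Real.exp (Y₂ ω)) ∂(P n)
        ≤ ENNReal.ofReal (1 + 5 ^ p n * A n ^ n) ∧
      ∀ ω, DataBound ρ τ (fun j => X n j ω) (fun j => ε n j ω)
        (1 + (⨆ j, |ε n j ω|) + (lam n)⁻¹ * Y₁ ω + 4 / (lam n * n) * Y₂ ω) := fun n => by
    by_cases h0 : 0 < n
    · obtain ⟨Y₁, Y₂, h⟩ := exists_dataBound h0 hρ hτ (hX.measurable n) (hε.measurable n)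
        (hX.indep n) (hXε n) (hlam n) (hA1 n) (hA n)
      exact ⟨Y₁, Y₂, fun _ => h⟩
    · exact ⟨fun _ => 0, fun _ => 0, fun h => absurd h h0⟩
  choose Y₁ Y₂ hY using hex
  refine ⟨_, ?_, (eventually_gt_atTop 0).mono fun n hn => (hY n hn).2.2.2.2.2.2⟩
  have hlA : ∀ n, 0 ≤ Real.log (A n) := fun n => Real.log_nonneg (hA1 n)
  refine ((MomentPolyLog.one.add ?_).add ?_).add ?_
  · obtain ⟨b, hb⟩ := hε.sup_size
    refine MomentPolyLog.of_eLpNorm_le (PolyLog.log_rpow b) fun k hk => ?_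
    obtain ⟨K, hK⟩ := hb k hk
    refine ⟨|K|, abs_nonneg _, ?_⟩
    filter_upwards [hK, eventually_one_le_log] with n hn hl
    refine ⟨hn.1.1, hn.2.trans (ENNReal.ofReal_le_ofReal ?_)⟩
    exact mul_le_mul_of_nonneg_right (le_abs_self K) (by positivity)
  · refine MomentPolyLog.of_exp (A := fun n => 1 + (n + n * n) * A n)
      ((eventually_gt_atTop 0).mono fun n hn =>
        ⟨(hY n hn).1, (hY n hn).2.2.1, (hY n hn).2.2.2.2.1⟩)
      (Eventually.of_forall fun n => ?_)
      (Eventually.of_forall fun n => (inv_pos.2 (hlam n)).le) (hPlam.mul ?_)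
    · have := hA1 n
      have : 0 ≤ ((n:ℝ) + n * n) * A n := by positivity
      linarith
    · refine PolyLog.of_le (g := fun n => (Real.log 3 + 2 * Real.log n + Real.log (A n)) + 1)
        ((((PolyLog.const _).add ((PolyLog.const 2).mul PolyLog.log)).add hPA).add
          (PolyLog.const 1)) ?_
      filter_upwards [eventually_ge_atTop 1] with n hn
      have hn1 : (1:ℝ) ≤ n := by exact_mod_cast hn
      have hAn := hA1 n
      have h0 : 0 ≤ ((n:ℝ) + n * n) * A n := by positivity
      refine ⟨add_nonneg (Real.log_nonneg (by linarith)) zero_le_one, ?_⟩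
      gcongr
      have e : Real.log 3 + 2 * Real.log n + Real.log (A n) = Real.log (3 * n ^ 2 * A n) := by
        rw [Real.log_mul (by positivity) (by positivity), Real.log_mul (by norm_num)
          (by positivity), Real.log_pow]
        norm_num
      rw [e]
      refine Real.log_le_log (by linarith) ?_
      have h1 : (n:ℝ) ≤ n ^ 2 := by nlinarith
      have h2 : 1 ≤ (n:ℝ) ^ 2 * A n := one_le_mul_of_one_le_of_one_le (by nlinarith) hAn
      nlinarith [mul_le_mul_of_nonneg_right h1 (by linarith : 0 ≤ A n)]
  · refine MomentPolyLog.of_exp (A := fun n => 1 + 5 ^ p n * A n ^ n)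
      ((eventually_gt_atTop 0).mono fun n hn =>
        ⟨(hY n hn).2.1, (hY n hn).2.2.2.1, (hY n hn).2.2.2.2.2.1⟩)
      (Eventually.of_forall fun n => ?_)
      (Eventually.of_forall fun n => by have := hlam n; positivity) ?_
    · have := hA1 n
      have : 0 ≤ (5:ℝ) ^ p n * A n ^ n := by positivity
      linarith
    · obtain ⟨κ, -, hκ⟩ := hp
      -- Proportionality of p and n enters here: the net costs p log 5, which the normalization 1/n
      -- of the Gram form must absorb.
      have hPp : PolyLog fun n => (p n : ℝ) / n := (PolyLog.const 1).of_isBigO (hκ.isBigO_one ℝ)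
      refine PolyLog.of_le (g := fun n => (lam n)⁻¹ * (4 * (Real.log 2 + 1
          + (p n : ℝ) / n * Real.log 5 + Real.log (A n))))
        (hPlam.mul ((PolyLog.const 4).mul (((PolyLog.const _).add (hPp.mul (PolyLog.const _))).add
          hPA))) ?_
      filter_upwards [eventually_ge_atTop 1] with n hn
      have hn1 : (1:ℝ) ≤ n := by exact_mod_cast hn
      have hAn := hA1 n
      have hln := hlam n
      have h5 : 1 ≤ (5:ℝ) ^ p n * A n ^ n :=
        one_le_mul_of_one_le_of_one_le (one_le_pow₀ (by norm_num)) (one_le_pow₀ hAn)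
      have h0 : 0 ≤ Real.log (1 + 5 ^ p n * A n ^ n) := Real.log_nonneg (by linarith)
      refine ⟨by positivity, ?_⟩
      have h1 : Real.log (1 + 5 ^ p n * A n ^ n)
          ≤ Real.log 2 + p n * Real.log 5 + n * Real.log (A n) := by
        have e : Real.log 2 + p n * Real.log 5 + n * Real.log (A n)
            = Real.log (2 * (5 ^ p n * A n ^ n)) := by
          rw [Real.log_mul (by norm_num) (by positivity), Real.log_mul (by positivity)
            (by positivity), Real.log_pow, Real.log_pow, add_assoc]
        rw [e]
        exact Real.log_le_log (by linarith) (by linarith)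
      have hl2 : 0 ≤ Real.log 2 + 1 := by have := Real.log_nonneg one_le_two; linarith
      calc 4 / (lam n * n) * (Real.log (1 + 5 ^ p n * A n ^ n) + 1)
          ≤ 4 / (lam n * n) * (n * (Real.log 2 + 1) + p n * Real.log 5 + n * Real.log (A n)) := by
            refine mul_le_mul_of_nonneg_left ?_ (by positivity)
            nlinarith
        _ = _ := by field_simp

end Main

end RobustRidge

end

/-! ### The theorem -/

open RobustRidge

theorem mainTheorem3
    {Ω : ℕ → Type*} [∀ n, MeasurableSpace (Ω n)]
    (P : ∀ n, Measure (Ω n)) [∀ n, IsProbabilityMeasure (P n)]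
    (ρ : ℝ → ℝ) (τ : ℝ) (hτ : 0 < τ)
    (p : ℕ → ℕ)
    (X : ∀ n, Fin n → Ω n → EuclideanSpace ℝ (Fin (p n)))
    (ε : ∀ n, Fin n → Ω n → ℝ)
    (hp : ∃ κ : ℝ, 0 < κ ∧ Tendsto (fun n : ℕ => (p n : ℝ) / n) atTop (𝓝 κ))
    (hρ : RobustRidge.IsLoss ρ)
    (hgrowth : RobustRidge.LossGrowth ρ)
    (hX : RobustRidge.IsDesign P p X)
    (hXε : ∀ n, IndepFun (fun ω i => X n i ω) (fun ω i => ε n i ω) (P n))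
    (hε : RobustRidge.IsErrors P ρ ε) :
    ∃ a : ℕ,
      (∀ k : ℕ, 1 ≤ k → RobustRidge.BigOLkUnif P k
        (fun n i ω => ‖RobustRidge.betaHat ρ τ (fun j => X n j ω) (fun j => ε n j ω)
          - RobustRidge.betaTilde ρ τ (fun j => X n j ω) (fun j => ε n j ω) i‖)
        (fun n => Real.log n ^ a / n)) ∧
      (∃ K : ℝ, ∀ᶠ n : ℕ in atTop, ∀ i : Fin n,
        Integrable (fun ω => ‖RobustRidge.betaHat ρ τ (fun j => X n j ω) (fun j => ε n j ω)
          - RobustRidge.betaTilde ρ τ (fun j => X n j ω) (fun j => ε n j ω) i‖ ^ 2) (P n) ∧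
        ∫ ω, ‖RobustRidge.betaHat ρ τ (fun j => X n j ω) (fun j => ε n j ω)
          - RobustRidge.betaTilde ρ τ (fun j => X n j ω) (fun j => ε n j ω) i‖ ^ 2 ∂(P n)
          ≤ K * (Real.log n ^ a / (n : ℝ) ^ 2)) ∧
      (∀ k : ℕ, 1 ≤ k → RobustRidge.BigOLk P k
        (fun n ω => ⨆ i : Fin n, ⨆ j : {j : Fin n // j ≠ i},
          |RobustRidge.residLoo ρ τ (fun l => X n l ω) (fun l => ε n l ω) i j
            - RobustRidge.resid ρ τ (fun l => X n l ω) (fun l => ε n l ω) j|)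
        (fun n => Real.log n ^ a / Real.sqrt n)) ∧
      (∀ k : ℕ, 1 ≤ k → RobustRidge.BigOLk P k
        (fun n ω => ⨆ i : Fin n,
          |RobustRidge.resid ρ τ (fun l => X n l ω) (fun l => ε n l ω) i
            - RobustRidge.proxResid ρ τ (fun l => X n l ω) (fun l => ε n l ω) i|)
        (fun n => Real.log n ^ a / Real.sqrt n)) := by
  obtain ⟨D, M, hpl⟩ := exists_isPolyLoss hρ hgrowth
  obtain ⟨T, hT, hTb⟩ := exists_array_dataBound hτ hp hpl hX hXε hε
  obtain ⟨f, hf, hfb⟩ := exists_polyBdd_error hpl hτ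
  obtain ⟨b, hb⟩ := hT.exists_eLpNorm_le (hTb.mono fun n h ω => (h ω).one_le) hf
  have hdata : ∀ n, Measurable fun ω =>
      ((fun j => X n j ω : Fin n → EuclideanSpace ℝ (Fin (p n))), (fun j => ε n j ω : Fin n → ℝ)) :=
    fun n => (measurable_pi_lambda _ (hX.measurable n)).prodMk
      (measurable_pi_lambda _ (hε.measurable n))
  have mHat : ∀ n, Measurable fun ω => betaHat ρ τ (fun j => X n j ω) (fun j => ε n j ω) :=
    fun n => by
      have h := (continuous_betaHat (p := p n) hρ hτ).measurable.comp (hdata n)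
      exact h
  have mTilde : ∀ n i, Measurable fun ω => betaTilde ρ τ (fun j => X n j ω) (fun j => ε n j ω) i :=
    fun n i => by
      have h := (continuous_betaTilde (p := p n) hpl hτ i).measurable.comp (hdata n)
      exact h
  have mLoo : ∀ n i j, Measurable fun ω =>
      residLoo ρ τ (fun j => X n j ω) (fun j => ε n j ω) i j :=
    fun n i j => by
      have h := (continuous_residLoo (p := p n) hρ hτ i j).measurable.comp (hdata n)
      exact h
  have mRes : ∀ n i, Measurable fun ω => resid ρ τ (fun j => X n j ω) (fun j => ε n j ω) i :=
    fun n i => by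
      have h := (continuous_resid (p := p n) hρ hτ i).measurable.comp (hdata n)
      exact h
  have mProx : ∀ n i, Measurable fun ω => proxResid ρ τ (fun j => X n j ω) (fun j => ε n j ω) i :=
    fun n i => by
      have h := (continuous_proxResid (p := p n) hpl hτ i).measurable.comp (hdata n)
      exact h
  have mΔ : ∀ n i, Measurable fun ω => ‖betaHat ρ τ (fun j => X n j ω) (fun j => ε n j ω)
      - betaTilde ρ τ (fun j => X n j ω) (fun j => ε n j ω) i‖ := fun n i =>
    ((mHat n).sub (mTilde n i)).norm
  have hf0 : ∀ n ω, 1 ≤ T n ω → 0 ≤ f (T n ω) := fun n ω h => by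
    obtain ⟨C, M, _, hC⟩ := hf
    exact (hC _ h).1
  have hlog : ∀ {K r : ℝ} {n : ℕ}, 0 ≤ K → 0 ≤ r → 1 ≤ Real.log n →
      ENNReal.ofReal (K * Real.log n ^ b * r)
        ≤ ENNReal.ofReal (K * (Real.log n ^ (2 * b) * r)) := fun hK hr hl => by
    refine ENNReal.ofReal_le_ofReal ?_
    rw [mul_assoc]
    gcongr
    omega
  -- The exponent b suffices for the L_k bounds; squaring the L_2 bound doubles it, and a single
  -- exponent must serve all four claims.
  refine ⟨2 * b, fun k hk => ?_, ?_, fun k hk => ?_, fun k hk => ?_⟩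
  · obtain ⟨K, hK, hKb⟩ := hb k hk
    refine ⟨K, ?_⟩
    filter_upwards [hKb, hTb, eventually_one_le_log] with n hn hTn hl i
    have h := hn _ ((n : ℝ)⁻¹) (by positivity) (mΔ n i) fun ω => by
      rw [abs_norm, ← div_eq_mul_inv]
      exact (hfb (hTn ω) i).1
    exact ⟨h.1, h.2.trans (by rw [div_eq_mul_inv]; exact hlog hK (by positivity) hl)⟩
  · obtain ⟨K, hK, hKb⟩ := hb 2 one_le_two
    refine ⟨K ^ 2, ?_⟩
    filter_upwards [hKb, hTb, eventually_one_le_log] with n hn hTn hl i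
    have h := hn _ ((n : ℝ)⁻¹) (by positivity) (mΔ n i) fun ω => by
      rw [abs_norm, ← div_eq_mul_inv]
      exact (hfb (hTn ω) i).1
    simp only [Nat.cast_ofNat] at h
    refine ⟨h.1.integrable_sq, (integral_sq_le_of_eLpNorm_le (by positivity) h.1 h.2).trans_eq ?_⟩
    rw [mul_pow, mul_pow, ← pow_mul, mul_comm b 2, inv_pow, div_eq_mul_inv, mul_assoc]
  · obtain ⟨K, hK, hKb⟩ := hb k hk
    refine ⟨K, ?_⟩
    filter_upwards [hKb, hTb, eventually_one_le_log] with n hn hTn hl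
    have h := hn _ ((√n)⁻¹) (by positivity) (Measurable.iSup fun i => Measurable.iSup
      fun j : {j : Fin n // j ≠ i} => ((mLoo n i j).sub (mRes n j)).abs) fun ω => by
      have h0 := hf0 n ω (hTn ω).one_le
      rw [abs_of_nonneg (Real.iSup_nonneg fun i => Real.iSup_nonneg fun j => abs_nonneg _)]
      refine Real.iSup_le (fun i => Real.iSup_le (fun j => ?_) (by positivity)) (by positivity)
      rw [← div_eq_mul_inv]
      exact (hfb (hTn ω) i).2.1 j j.2
    exact ⟨h.1, h.2.trans (by rw [div_eq_mul_inv]; exact hlog hK (by positivity) hl)⟩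
  · obtain ⟨K, hK, hKb⟩ := hb k hk
    refine ⟨K, ?_⟩
    filter_upwards [hKb, hTb, eventually_one_le_log] with n hn hTn hl
    have h := hn _ ((√n)⁻¹) (by positivity) (Measurable.iSup fun i =>
      ((mRes n i).sub (mProx n i)).abs) fun ω => by
      have h0 := hf0 n ω (hTn ω).one_le
      rw [abs_of_nonneg (Real.iSup_nonneg fun i => abs_nonneg _)]
      refine Real.iSup_le (fun i => ?_) (by positivity)
      rw [← div_eq_mul_inv]
      exact (hfb (hTn ω) i).2.2
    exact ⟨h.1, h.2.trans (by rw [div_eq_mul_inv]; exact hlog hK (by positivity) hl)⟩
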